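/- **Setting.** For $a\in\mathbb R$ let $L_a(x)=x+a$. Fix a homeomorphism $\hbar:\mathbb R\to(0,1)$. For $\sigma\in\mathrm{Homeo}_+(\mathbb R)$ let $\hbar(\sigma)\in\mathrm{Homeo}_+(\mathbb R)$ be the map that fixes every integer and equals $x\mapsto\hbar\sigma\hbar^{-1}(x-i)+i$ on $(i,i+1)$ for every $i\in\mathbb Z$; $\hbar^{(j)}$ denotes the $j$-fold iterate of $\sigma\mapsto\hbar(\sigma)$. For an irrational $\alpha\in(0,1)$ put $G_{\alpha,2}=\langle L_1,L_\alpha\rangle$ and $G_{\alpha,n+1}=\langle\{\hbar(\sigma):\sigma\in G_{\alpha,n}\}\cup\{L_1\}\rangle$ for $n\ge 2$. The group $G_{\alpha,n}$ is free abelian of rank $n$ with *standard basis* $e_1=\hbar^{(n-2)}(L_1)$, $e_2=\hbar^{(n-2)}(L_\alpha)$, $e_j=\hbar^{(n-j)}(L_1)$ for $3\le j\le n$; the coordinate vector of $e_1^{u_1}\cdots e_n^{u_n}$ is $(u_1,\dots,u_n)^T\in\mathbb Z^n$. Let $k\ge 1$, $x_j=e^{2\pi \mathbf i j/k}$, and fix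 an orientation preserving homeomorphism $\phi$ from $\mathbb R$ onto the open anticlockwise arc $(x_1,x_2)$ of $\mathbb S^1$ (all of $\mathbb S^1\setminus\{x_1\}$ if $k=1$). Let $g\in G_{\alpha,n}$ be such that $g$ is not an $s$-th power in $G_{\alpha,n}$ for any $s\ge 1$ with $\gcd(k,s)\ne 1$, and let $f\in\mathrm{Homeo}_+(\mathbb S^1)$ satisfy $f(x_j)=x_{j+1}$ for all $j$ and $f^k|_{(x_1,x_2)}=\phi g\phi^{-1}$. For $\sigma\in\mathrm{Homeo}_+(\mathbb R)$ let $\overline\sigma\in\mathrm{Homeo}_+(\mathbb S^1)$ fix every $x_j$ and equal $f^{i-1}\phi\sigma\phi^{-1}f^{-(i-1)}$ on the arc $(x_i,x_{i+1})$, $1\le i\le k$. Let $G_{\alpha,n,k,g,f}$ be the subgroup of $\mathrm{Homeo}_+(\mathbb S^1)$ generated by $f$ and all $\overline\sigma$ with $\sigma\in G_{\alpha,n}$. Two subgroups $G,H$ of $\mathrm{Homeo}_+(\mathbb S^1)$ are *topologically conjugate* if $\psi G\psi^{-1}=H$ for some $\psi\in\mathrm{Homeo}_+(\mathbb S^1)$.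 **Theorem.** Let $n,n'\ge2$, $k,k'\ge1$, let $\alpha,\alpha'\in(0,1)$ be irrational, and let $(g,f)$ and $(g',f')$ be as above for $(\alpha,n,k)$ and $(\alpha',n',k')$ respectively (with the same $\hbar$; the maps $\phi$ used for the two groups may be chosen independently). Then $G_{\alpha,n,k,g,f}$ is topologically conjugate to $G_{\alpha',n',k',g',f'}$ if and only if * $n=n'$ and $k=k'$; * there exist $$A=\begin{pmatrix}m_2&m_1\\ n_2&n_1\end{pmatrix}\in GL(2,\mathbb Z)\quad\text{with}\quad m_2+n_2\alpha>0,\quad \alpha'=\frac{m_1+n_1\alpha}{m_2+n_2\alpha},$$ a matrix $f_\alpha\in F_\alpha$, where $$F_\alpha=\left\{\begin{pmatrix}q_2&q_1\\ r_2&r_1\end{pmatrix}\in GL(2,\mathbb Z): q_2+r_2\alpha>0,\ \alpha=\frac{q_1+r_1\alpha}{q_2+r_2\alpha}\right\},$$ an upper triangular matrix $B\in GL(n-2,\mathbb Z)$ with all diagonal entries $1$, an arbitrary integral $2\times(n-2)$ matrix $C$, and a vector $\vec w\in k\mathbb Z^n$ such that $$\vec v=\begin{pmatrix}f_\alpha&C\\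 0&B\end{pmatrix}\begin{pmatrix}A&0\\ 0&I_{n-2}\end{pmatrix}\vec u+\vec w,$$ where $\vec v$ is the coordinate vector of $g$ in the standard basis of $G_{\alpha,n}$ and $\vec u$ is the coordinate vector of $g'$ in the standard basis of $G_{\alpha',n}$. -/

import Mathlib

noncomputable section

namespace TightCircle

open Set

/-! ### Groups acting on the line

The group of orientation preserving homeomorphisms of `ℝ` is the group `ℝ ≃o ℝ` of increasing
bijections of `ℝ` (these are automatically homeomorphisms), with composition as product. -/

/-- The translation `x ↦ x + a`. -/
def transl (a : ℝ) : ℝ ≃o ℝ := OrderIso.addRight a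

/-- For a homeomorphism `h : ℝ → (0,1)`, the map which is `x ↦ h (σ (h⁻¹ (x - i))) + i` on each
open interval `(i, i+1)`, `i ∈ ℤ`, and fixes each integer. -/
def liftFun (h : ℝ ≃ₜ Ioo (0 : ℝ) 1) (σ : ℝ ≃o ℝ) (x : ℝ) : ℝ :=
  if hx : 0 < Int.fract x then
    (h (σ (h.symm ⟨Int.fract x, hx, Int.fract_lt_one x⟩)) : ℝ) + ⌊x⌋
  else x

lemma conj_lt (h : ℝ ≃ₜ Ioo (0 : ℝ) 1) (σ : ℝ ≃o ℝ) {a b : Ioo (0 : ℝ) 1} (hab : a < b) :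
    h (σ (h.symm a)) < h (σ (h.symm b)) := by
  have hc : Continuous fun t : ℝ => ((h t : Ioo (0 : ℝ) 1) : ℝ) :=
    continuous_subtype_val.comp h.continuous
  have hi : Function.Injective fun t : ℝ => ((h t : Ioo (0 : ℝ) 1) : ℝ) :=
    Subtype.val_injective.comp h.injective
  have hab' : ((h (h.symm a) : Ioo (0 : ℝ) 1) : ℝ) < (h (h.symm b) : Ioo (0 : ℝ) 1) := by
    simpa using hab
  rcases hc.strictMono_of_inj hi with hm | hm
  · exact hm (σ.strictMono (hm.lt_iff_lt.1 hab'))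
  · exact hm (σ.strictMono (hm.lt_iff_gt.1 hab'))

lemma liftFun_floor (h : ℝ ≃ₜ Ioo (0 : ℝ) 1) (σ : ℝ ≃o ℝ) (x : ℝ) :
    ⌊liftFun h σ x⌋ = ⌊x⌋ := by
  unfold liftFun
  split_ifs with hx
  · set y := h (σ (h.symm ⟨Int.fract x, hx, Int.fract_lt_one x⟩))
    rw [Int.floor_add_intCast, Int.floor_eq_zero_iff.2 ⟨y.2.1.le, y.2.2⟩, zero_add]
  · rfl

lemma liftFun_strictMono (h : ℝ ≃ₜ Ioo (0 : ℝ) 1) (σ : ℝ ≃o ℝ) : StrictMono (liftFun h σ) := by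
  intro x y hxy
  rcases (Int.floor_mono hxy.le).lt_or_eq with hf | hf
  · rw [← liftFun_floor h σ x, ← liftFun_floor h σ y] at hf
    exact Int.floor_mono.reflect_lt hf
  · have hfr : Int.fract x < Int.fract y := by
      unfold Int.fract; rw [hf]; linarith
    have hy : 0 < Int.fract y := (Int.fract_nonneg x).trans_lt hfr
    unfold liftFun
    rw [dif_pos hy]
    split_ifs with hx
    · rw [hf]
      have := conj_lt h σ (a := ⟨Int.fract x, hx, Int.fract_lt_one x⟩)
        (b := ⟨Int.fract y, hy, Int.fract_lt_one y⟩) hfr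
      exact add_lt_add_left (show ((h _ : Ioo (0 : ℝ) 1) : ℝ) < (h _ : Ioo (0 : ℝ) 1) from this) _
    · have hx0 : Int.fract x = 0 := le_antisymm (not_lt.1 hx) (Int.fract_nonneg x)
      have := (h (σ (h.symm ⟨Int.fract y, hy, Int.fract_lt_one y⟩))).2.1
      have hx1 := Int.floor_add_fract x
      rw [← hf]
      linarith

lemma liftFun_rightInverse (h : ℝ ≃ₜ Ioo (0 : ℝ) 1) (σ : ℝ ≃o ℝ) :
    Function.RightInverse (liftFun h σ⁻¹) (liftFun h σ) := by
  intro x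
  have hfl := liftFun_floor h σ⁻¹ x
  by_cases hx : 0 < Int.fract x
  · have hv : liftFun h σ⁻¹ x =
        (h (σ⁻¹ (h.symm ⟨Int.fract x, hx, Int.fract_lt_one x⟩)) : ℝ) + ⌊x⌋ := dif_pos hx
    have hfr : Int.fract (liftFun h σ⁻¹ x) =
        (h (σ⁻¹ (h.symm ⟨Int.fract x, hx, Int.fract_lt_one x⟩)) : ℝ) := by
      unfold Int.fract at hv ⊢; rw [hfl, hv]; ring
    have hp : 0 < Int.fract (liftFun h σ⁻¹ x) := hfr ▸ (h _).2.1
    have he : (⟨Int.fract (liftFun h σ⁻¹ x), hp, Int.fract_lt_one _⟩ : Ioo (0 : ℝ) 1) =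
        h (σ⁻¹ (h.symm ⟨Int.fract x, hx, Int.fract_lt_one x⟩)) := Subtype.ext hfr
    rw [liftFun, dif_pos hp, he, hfl, h.symm_apply_apply, RelIso.apply_inv_self,
      h.apply_symm_apply]
    exact Int.fract_add_floor x
  · have hv : liftFun h σ⁻¹ x = x := dif_neg hx
    rw [hv]; exact dif_neg hx

/-- The endomorphism of the group of orientation preserving homeomorphisms of `ℝ` induced by a
homeomorphism `h : ℝ → (0,1)`: `σ` is copied by `h` into each interval `(i, i+1)`. -/
def lift (h : ℝ ≃ₜ Ioo (0 : ℝ) 1) (σ : ℝ ≃o ℝ) : ℝ ≃o ℝ :=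
  (liftFun_strictMono h σ).orderIsoOfRightInverse (liftFun h σ) (liftFun h σ⁻¹)
    (liftFun_rightInverse h σ)

/-- `lineGroup h α m` is the group `G_{α, m+2}`: it is `⟨L₁, L_α⟩` for `m = 0`, and `G_{α, n+1}` is
generated by `lift h σ`, `σ ∈ G_{α, n}`, and `L₁`. -/
def lineGroup (h : ℝ ≃ₜ Ioo (0 : ℝ) 1) (α : ℝ) : ℕ → Subgroup (ℝ ≃o ℝ)
  | 0 => Subgroup.closure {transl 1, transl α}
  | m + 1 => Subgroup.closure (lift h '' (lineGroup h α m : Set (ℝ ≃o ℝ)) ∪ {transl 1})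

/-- The element of `G_{α, m+2}` with coordinates `u` in the standard basis
`e₁ = lift^m L₁, e₂ = lift^m L_α, e₃ = lift^(m-1) L₁, …, e_{m+2} = L₁`. The index set is
`Fin 2 ⊕ Fin m`: `inl 0, inl 1` stand for `1, 2` and `inr j` stands for `j + 3`. -/
def ofCoords (h : ℝ ≃ₜ Ioo (0 : ℝ) 1) (α : ℝ) (m : ℕ) (u : Fin 2 ⊕ Fin m → ℤ) : ℝ ≃o ℝ :=
  ((lift h)^[m] (transl 1)) ^ u (Sum.inl 0) * ((lift h)^[m] (transl α)) ^ u (Sum.inl 1) *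
    (List.ofFn fun j : Fin m => ((lift h)^[m - 1 - j] (transl 1)) ^ u (Sum.inr j)).prod

/-! ### Groups acting on the circle -/

/-- A homeomorphism of the unit circle is orientation preserving if it lifts to a continuous
strictly increasing map of the line through `t ↦ exp (i t)`. -/
def OrientationPreserving (f : Circle ≃ₜ Circle) : Prop :=
  ∃ F : ℝ → ℝ, Continuous F ∧ StrictMono F ∧ ∀ t : ℝ, f (Circle.exp t) = Circle.exp (F t)

/-- The angle `2πj/k`. -/
def angle (k j : ℕ) : ℝ := 2 * Real.pi * j / k

/-- The point `x_j = exp (2πij/k)` of the unit circle. -/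
def pt (k j : ℕ) : Circle := Circle.exp (angle k j)

/-- An orientation preserving homeomorphism from `ℝ` onto the open arc `(x₁, x₂)`, read
anticlockwise, is given by its angle, an increasing bijection from `ℝ` onto `(2π/k, 4π/k)`. -/
abbrev ArcChart (k : ℕ) : Type := ℝ ≃o Ioo (angle k 1) (angle k 2)

/-- The map from `ℝ` onto the arc `(x₁, x₂)` given by an `ArcChart`. -/
def ArcChart.toCircle {k : ℕ} (φ : ArcChart k) (t : ℝ) : Circle := Circle.exp (φ t : ℝ)

/-- `f` is an orientation preserving homeomorphism of the circle with `f x_j = x_{j+1}` for all `j`,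
whose `k`-th power is `φ g φ⁻¹` on `(x₁, x₂)`. -/
structure IsRoot {k : ℕ} (φ : ArcChart k) (g : ℝ ≃o ℝ) (f : Circle ≃ₜ Circle) : Prop where
  orientationPreserving : OrientationPreserving f
  map_pt : ∀ j : ℕ, f (pt k j) = pt k (j + 1)
  pow_eq : ∀ t : ℝ, (f ^ k) (φ.toCircle t) = φ.toCircle (g t)

/-- `τ` is the extension of `σ` to the circle by means of `f`: it fixes every `x_j`, and it is
`f^i φ σ φ⁻¹ f^{-i}` on the arc `(x_{i+1}, x_{i+2}) = f^i (x₁, x₂)` for `0 ≤ i < k`. -/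
def IsExtension {k : ℕ} (φ : ArcChart k) (f : Circle ≃ₜ Circle) (σ : ℝ ≃o ℝ)
    (τ : Circle ≃ₜ Circle) : Prop :=
  (∀ j : ℕ, τ (pt k j) = pt k j) ∧
    ∀ i < k, ∀ t : ℝ, τ ((f ^ i) (φ.toCircle t)) = (f ^ i) (φ.toCircle (σ t))

/-- The subgroup of the homeomorphism group of the circle generated by `f` and by the extensions
of the elements of `G_{α, n}`. -/
def circleGroup (h : ℝ ≃ₜ Ioo (0 : ℝ) 1) (α : ℝ) (n : ℕ) {k : ℕ} (φ : ArcChart k)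
    (f : Circle ≃ₜ Circle) : Subgroup (Circle ≃ₜ Circle) :=
  Subgroup.closure ({τ | ∃ σ ∈ lineGroup h α (n - 2), IsExtension φ f σ τ} ∪ {f})

/-- Two groups of circle homeomorphisms are topologically conjugate if `ψ G ψ⁻¹ = H` for some
orientation preserving homeomorphism `ψ` of the circle. -/
def TopConjugate (G H : Subgroup (Circle ≃ₜ Circle)) : Prop :=
  ∃ ψ : Circle ≃ₜ Circle, OrientationPreserving ψ ∧ G.map (MulAut.conj ψ).toMonoidHom = H

/-- For `A = !![m₂, m₁; n₂, n₁]`: `m₂ + n₂ α > 0` and `β = (m₁ + n₁ α) / (m₂ + n₂ α)`. -/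
def MoebiusRel (A : GL (Fin 2) ℤ) (α β : ℝ) : Prop :=
  0 < (A.1 0 0 : ℝ) + A.1 1 0 * α ∧
    β = ((A.1 0 1 : ℝ) + A.1 1 1 * α) / ((A.1 0 0 : ℝ) + A.1 1 0 * α)

/-- The integral matrices that stabilize `α`, normalized by
`m₂ + n₂ α > 0` (conjugation by an orientation preserving map sends `L₁` to `L_u` with `u > 0`). -/
def stabMatrices (α : ℝ) : Set (GL (Fin 2) ℤ) := {A | MoebiusRel A α α}

end TightCircle

end

open TightCircle

noncomputable section

namespace TightCircle

open Set

/-! ### Suspensions of groups acting on the unit interval -/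

/-! Both kinds of groups are handled as suspensions. Given a homeomorphism `F` of the line with `F j
= j + 1` on the integers, a bijection of `(0,1)` extends uniquely to a homeomorphism of the line
that fixes `0` and commutes with `F`; the extensions of a group `K` together with `F` form
`suspension hF K`. Each line group is a suspension of the previous one with `F = L₁`
(`lineGroup_succ`), and the group of all lifts of a circle group is a suspension of a copy of the
line group, with `F` a lift of the root `f` (`isPreimage_closure`).

If `K` and `K'` contain elements without fixed points and `K` is abelian, conjugacies of suspensions
are rigid (`Conjugates.of_suspension`): integers go to integers, so up to a central power of `F` the
conjugacy restricts to a conjugacy `w` of `K'` onto `K` on `(0,1)`, and it sends `F'` to `γF` with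
`γ ∈ K`. Conversely every pair `(w, γ)` occurs (`exists_conj_suspension`).

On line groups, induction turns this into matrices. At the bottom, an order preserving isomorphism
between groups of translations is a scaling, which gives the Möbius relation. Each further level
adds one column, the coordinates of `γ`, with `1` on the diagonal. Hence conjugacies act on
coordinates exactly by the matrices with blocks `A, C, 0, B` (`Conjugates.exists_matrix`,
`exists_conj_of_matrix`).

On the circle, a conjugacy must also carry one deck transformation to the other. Since `F ^ k` is
the extension of `g` times the deck transformation `T_k`, and `F'` goes to `γF`, this forces `k =
k'` and says that `g` and the conjugate of `g'` differ by a `k`-th power, which is the vector of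
`kℤⁿ`. The stabilizer matrix is absorbed by multiplicativity of `MoebiusRel`. -/

/-- The group of increasing bijections of the open unit interval. -/
abbrev UnitAut : Type := Ioo (0 : ℝ) 1 ≃o Ioo (0 : ℝ) 1

/-- A homeomorphism of the line which shifts the integers by one. -/
def IsStep (F : ℝ ≃o ℝ) : Prop := ∀ j : ℤ, F j = j + 1

lemma isStep_transl : IsStep (transl 1) := fun _ => rfl

lemma zpow_succ_apply (F : ℝ ≃o ℝ) (i : ℤ) (x : ℝ) : (F ^ (i + 1)) x = (F ^ i) (F x) := by
  rw [zpow_add_one]; rfl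

lemma zpow_succ_apply' (F : ℝ ≃o ℝ) (i : ℤ) (x : ℝ) : (F ^ (i + 1)) x = F ((F ^ i) x) := by
  rw [add_comm, zpow_one_add]; rfl

lemma zpow_zpow_neg_apply (F : ℝ ≃o ℝ) (i : ℤ) (x : ℝ) : (F ^ i) ((F ^ (-i)) x) = x := by
  rw [← RelIso.mul_apply, ← zpow_add, add_neg_cancel, zpow_zero, RelIso.one_apply]

lemma zpow_neg_zpow_apply (F : ℝ ≃o ℝ) (i : ℤ) (x : ℝ) : (F ^ (-i)) ((F ^ i) x) = x := by
  rw [← RelIso.mul_apply, ← zpow_add, neg_add_cancel, zpow_zero, RelIso.one_apply]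

lemma IsStep.zpow_apply {F : ℝ ≃o ℝ} (hF : IsStep F) (i j : ℤ) : (F ^ i) j = j + i := by
  induction i using Int.induction_on with
  | zero => simp
  | succ i ih => rw [zpow_succ_apply', ih]; have := hF (j + i); push_cast at this ⊢; linarith
  | pred i ih =>
    apply F.injective
    rw [← zpow_succ_apply', sub_add_cancel, ih]
    have := hF (j + (-i - 1)); push_cast at this ⊢; linarith

lemma IsStep.floor_zpow {F : ℝ ≃o ℝ} (hF : IsStep F) (i : ℤ) (x : ℝ) :
    ⌊(F ^ i) x⌋ = ⌊x⌋ + i := by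
  rw [Int.floor_eq_iff]
  constructor
  · have := (F ^ i).monotone (Int.floor_le x)
    rw [hF.zpow_apply] at this; push_cast; exact this
  · have := (F ^ i).strictMono (Int.lt_floor_add_one x)
    have h2 := hF.zpow_apply i (⌊x⌋ + 1)
    push_cast at h2 ⊢; rw [h2] at this; linarith

lemma IsStep.zpow_floor_mem {F : ℝ ≃o ℝ} (hF : IsStep F) (x : ℝ) :
    (F ^ (-⌊x⌋)) x ∈ Ico (0 : ℝ) 1 := by
  have := hF.floor_zpow (-⌊x⌋) x
  rw [add_neg_cancel, Int.floor_eq_zero_iff] at this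
  exact this

/-- Extension by the identity of a bijection of the open unit interval. -/
def extendFun (u : UnitAut) (y : ℝ) : ℝ := if hy : y ∈ Ioo (0 : ℝ) 1 then u ⟨y, hy⟩ else y

lemma extendFun_of_mem (u : UnitAut) (y : Ioo (0 : ℝ) 1) : extendFun u y = u y := by
  exact dif_pos y.2

lemma extendFun_zero (u : UnitAut) : extendFun u 0 = 0 := by simp [extendFun]

lemma mem_Ico_cases {y : ℝ} (hy : y ∈ Ico (0 : ℝ) 1) : y = 0 ∨ ∃ z : Ioo (0 : ℝ) 1, y = z := by
  rcases hy.1.eq_or_lt with h | h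
  · exact Or.inl h.symm
  · exact Or.inr ⟨⟨y, h, hy.2⟩, rfl⟩

lemma extendFun_mem (u : UnitAut) {y : ℝ} (hy : y ∈ Ico (0 : ℝ) 1) :
    extendFun u y ∈ Ico (0 : ℝ) 1 := by
  rcases mem_Ico_cases hy with rfl | ⟨z, rfl⟩
  · simp [extendFun_zero]
  · rw [extendFun_of_mem]; exact ⟨(u z).2.1.le, (u z).2.2⟩

lemma extendFun_strictMonoOn (u : UnitAut) : StrictMonoOn (extendFun u) (Ico (0 : ℝ) 1) := by
  intro x hx y hy hxy
  rcases mem_Ico_cases hx with rfl | ⟨z, rfl⟩ <;> rcases mem_Ico_cases hy with rfl | ⟨w, rfl⟩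
  · exact (lt_irrefl _ hxy).elim
  · rw [extendFun_zero, extendFun_of_mem]; exact (u w).2.1
  · exact absurd hxy (not_lt.2 z.2.1.le)
  · rw [extendFun_of_mem, extendFun_of_mem]; exact u.strictMono hxy

lemma extendFun_mul (v u : UnitAut) {y : ℝ} (hy : y ∈ Ico (0 : ℝ) 1) :
    extendFun v (extendFun u y) = extendFun (v * u) y := by
  rcases mem_Ico_cases hy with rfl | ⟨z, rfl⟩
  · simp [extendFun_zero]
  · simp only [extendFun_of_mem]; rfl

/-- The map which is `u` on `(0,1)` and conjugates `F` to `F'`. -/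
def glueFun (F F' : ℝ ≃o ℝ) (u : UnitAut) (x : ℝ) : ℝ :=
  (F' ^ ⌊x⌋) (extendFun u ((F ^ (-⌊x⌋)) x))

section

variable {F F' F'' : ℝ ≃o ℝ}

lemma floor_glueFun (hF : IsStep F) (hF' : IsStep F') (u : UnitAut) (x : ℝ) :
    ⌊glueFun F F' u x⌋ = ⌊x⌋ := by
  rw [glueFun, hF'.floor_zpow, Int.floor_eq_zero_iff.2 (extendFun_mem u (hF.zpow_floor_mem x)),
    zero_add]

lemma glueFun_strictMono (hF : IsStep F) (hF' : IsStep F') (u : UnitAut) :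
    StrictMono (glueFun F F' u) := by
  intro x y hxy
  rcases (Int.floor_mono hxy.le).lt_or_eq with hf | hf
  · rw [← floor_glueFun hF hF' u x, ← floor_glueFun hF hF' u y] at hf
    exact Int.floor_mono.reflect_lt hf
  · have hx := hF.zpow_floor_mem x
    have hy := hF.zpow_floor_mem y
    unfold glueFun
    rw [← hf] at hy ⊢
    exact (F' ^ _).strictMono (extendFun_strictMonoOn u hx hy ((F ^ _).strictMono hxy))

lemma glueFun_glueFun (hF : IsStep F) (hF' : IsStep F') (v u : UnitAut) (x : ℝ) :
    glueFun F' F'' v (glueFun F F' u x) = glueFun F F'' (v * u) x := by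
  conv_lhs => unfold glueFun
  rw [show ⌊(F' ^ ⌊x⌋) (extendFun u ((F ^ (-⌊x⌋)) x))⌋ = ⌊x⌋ from floor_glueFun hF hF' u x,
    zpow_neg_zpow_apply, extendFun_mul v u (hF.zpow_floor_mem x)]
  rfl

lemma glueFun_one (x : ℝ) : glueFun F F 1 x = x := by
  have : extendFun (1 : UnitAut) ((F ^ (-⌊x⌋)) x) = (F ^ (-⌊x⌋)) x := by
    unfold extendFun; split_ifs <;> rfl
  rw [glueFun, this, zpow_zpow_neg_apply]

/-- The homeomorphism which is `u` on `(0,1)` and conjugates `F` to `F'`. -/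
def glue (hF : IsStep F) (hF' : IsStep F') (u : UnitAut) : ℝ ≃o ℝ :=
  (glueFun_strictMono hF hF' u).orderIsoOfRightInverse (glueFun F F' u) (glueFun F' F u⁻¹)
    fun x => by rw [glueFun_glueFun hF' hF, mul_inv_cancel, glueFun_one]

lemma glue_apply (hF : IsStep F) (hF' : IsStep F') (u : UnitAut) (x : ℝ) :
    glue hF hF' u x = glueFun F F' u x := rfl

lemma glue_mul (hF : IsStep F) (hF' : IsStep F') (hF'' : IsStep F'') (v u : UnitAut) :
    glue hF' hF'' v * glue hF hF' u = glue hF hF'' (v * u) :=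
  RelIso.ext fun x => glueFun_glueFun hF hF' v u x

lemma glue_apply_unit (hF : IsStep F) (hF' : IsStep F') (u : UnitAut) (y : Ioo (0 : ℝ) 1) :
    glue hF hF' u y = u y := by
  rw [glue_apply, glueFun, Int.floor_eq_zero_iff.2 ⟨y.2.1.le, y.2.2⟩]
  simp [extendFun_of_mem]

lemma glue_apply_int (hF : IsStep F) (hF' : IsStep F') (u : UnitAut) (j : ℤ) :
    glue hF hF' u j = j := by
  rw [glue_apply, glueFun, Int.floor_intCast, hF.zpow_apply]
  have := hF'.zpow_apply j 0
  simp [extendFun_zero] at this ⊢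
  exact this

lemma glue_apply_zero (hF : IsStep F) (hF' : IsStep F') (u : UnitAut) : glue hF hF' u 0 = 0 := by
  simpa using glue_apply_int hF hF' u 0

lemma glue_mul_step (hF : IsStep F) (hF' : IsStep F') (u : UnitAut) :
    glue hF hF' u * F = F' * glue hF hF' u := by
  refine RelIso.ext fun x => ?_
  have hfl : ⌊F x⌋ = ⌊x⌋ + 1 := by simpa using hF.floor_zpow 1 x
  have : (F ^ (-(⌊x⌋ + 1))) (F x) = (F ^ (-⌊x⌋)) x := by
    rw [← zpow_succ_apply]; congr 2; ring
  rw [RelIso.mul_apply, RelIso.mul_apply, glue_apply, glue_apply, glueFun, glueFun, hfl,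
    zpow_succ_apply', this]

/-- Every point is an `F`-translate of a point of `[0,1)`, so the values there and the intertwining
relation determine the map. -/
lemma eq_glue (hF : IsStep F) (hF' : IsStep F') (u : UnitAut) {Ψ : ℝ ≃o ℝ} (h0 : Ψ 0 = 0)
    (hc : Ψ * F = F' * Ψ) (hu : ∀ y : Ioo (0 : ℝ) 1, Ψ y = u y) : Ψ = glue hF hF' u := by
  have hc' : ∀ i : ℤ, Ψ * F ^ i = F' ^ i * Ψ := fun i =>
    (show SemiconjBy Ψ F F' from hc).zpow_right i
  refine RelIso.ext fun x => ?_
  have hx : x = (F ^ ⌊x⌋) ((F ^ (-⌊x⌋)) x) := (zpow_zpow_neg_apply F _ x).symm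
  have h1 : Ψ x = (F' ^ ⌊x⌋) (Ψ ((F ^ (-⌊x⌋)) x)) := by
    conv_lhs => rw [hx]
    exact DFunLike.congr_fun (hc' ⌊x⌋) _
  rw [h1, glue_apply, glueFun]
  congr 1
  rcases mem_Ico_cases (hF.zpow_floor_mem x) with h | ⟨z, h⟩
  · rw [h, h0, extendFun_zero]
  · rw [h, extendFun_of_mem, hu]

lemma glue_injective (hF : IsStep F) (hF' : IsStep F') : Function.Injective (glue hF hF') := by
  intro u v huv
  refine RelIso.ext fun y => Subtype.ext ?_
  rw [← glue_apply_unit hF hF', huv, glue_apply_unit]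

/-- The homomorphism extending a bijection of `(0,1)` to a homeomorphism of the line that fixes the
integers and commutes with `F`. -/
def equivariant (hF : IsStep F) : UnitAut →* (ℝ ≃o ℝ) where
  toFun := glue hF hF
  map_one' := RelIso.ext fun x => glueFun_one x
  map_mul' v u := (glue_mul hF hF hF v u).symm

lemma equivariant_commute (hF : IsStep F) (u : UnitAut) : Commute (equivariant hF u) F :=
  glue_mul_step hF hF u

lemma equivariant_apply_unit (hF : IsStep F) (u : UnitAut) (y : Ioo (0 : ℝ) 1) :
    equivariant hF u y = u y := glue_apply_unit hF hF u y

lemma equivariant_apply_int (hF : IsStep F) (u : UnitAut) (j : ℤ) :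
    equivariant hF u j = j := glue_apply_int hF hF u j

lemma equivariant_apply_zero (hF : IsStep F) (u : UnitAut) : equivariant hF u 0 = 0 :=
  glue_apply_zero hF hF u

lemma equivariant_injective (hF : IsStep F) : Function.Injective (equivariant hF) :=
  glue_injective hF hF

lemma floor_equivariant (hF : IsStep F) (u : UnitAut) (x : ℝ) : ⌊equivariant hF u x⌋ = ⌊x⌋ :=
  floor_glueFun hF hF u x

/-- The conjugate of an equivariant extension by a glued map. -/
lemma glue_conj_equivariant (hF : IsStep F) (hF' : IsStep F') (w u : UnitAut) :
    glue hF hF' w * equivariant hF u * (glue hF hF' w)⁻¹ = equivariant hF' (w * u * w⁻¹) := by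
  rw [mul_inv_eq_iff_eq_mul]
  change glue hF hF' w * glue hF hF u = glue hF' hF' _ * glue hF hF' w
  rw [glue_mul, glue_mul, inv_mul_cancel_right]

lemma glue_conj_step (hF : IsStep F) (hF' : IsStep F') (w : UnitAut) :
    glue hF hF' w * F * (glue hF hF' w)⁻¹ = F' := by
  rw [mul_inv_eq_iff_eq_mul, glue_mul_step]

lemma IsStep.equivariant_mul (hF : IsStep F) (u : UnitAut) : IsStep (equivariant hF u * F) := by
  intro j
  rw [RelIso.mul_apply, hF j]
  exact_mod_cast equivariant_apply_int hF u (j + 1)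

/-- Changing the step by an element commuting with `u` does not change the extension of `u`. -/
lemma equivariant_congr (hF : IsStep F) {γ u : UnitAut} (hc : Commute u γ) :
    equivariant (hF.equivariant_mul γ) u = equivariant hF u := by
  refine (eq_glue (hF.equivariant_mul γ) (hF.equivariant_mul γ) u
    (equivariant_apply_zero hF u) ?_ (equivariant_apply_unit hF u)).symm
  exact ((hc.map (equivariant hF)).mul_right (equivariant_commute hF u))

/-- The group generated by a step and the extensions of a group of bijections of `(0,1)`. -/
def suspension (hF : IsStep F) (K : Subgroup UnitAut) : Subgroup (ℝ ≃o ℝ) where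
  carrier := {x | ∃ u ∈ K, ∃ i : ℤ, x = equivariant hF u * F ^ i}
  one_mem' := ⟨1, K.one_mem, 0, by simp⟩
  mul_mem' := by
    rintro _ _ ⟨u, hu, i, rfl⟩ ⟨v, hv, j, rfl⟩
    refine ⟨u * v, K.mul_mem hu hv, i + j, ?_⟩
    rw [map_mul, zpow_add, mul_assoc, ← mul_assoc (F ^ i),
      ← ((equivariant_commute hF v).zpow_right i).eq]
    simp only [mul_assoc]
  inv_mem' := by
    rintro _ ⟨u, hu, i, rfl⟩
    refine ⟨u⁻¹, K.inv_mem hu, -i, ?_⟩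
    rw [mul_inv_rev, ← zpow_neg, map_inv,
      (((equivariant_commute hF u).zpow_right (-i)).inv_left).eq]

lemma equivariant_mem_suspension (hF : IsStep F) {K : Subgroup UnitAut} {u : UnitAut}
    (hu : u ∈ K) : equivariant hF u ∈ suspension hF K := ⟨u, hu, 0, by simp⟩

lemma step_mem_suspension (hF : IsStep F) (K : Subgroup UnitAut) : F ∈ suspension hF K :=
  ⟨1, K.one_mem, 1, by simp⟩

lemma suspension_comm (hF : IsStep F) {K : Subgroup UnitAut}
    (hK : ∀ a ∈ K, ∀ b ∈ K, a * b = b * a) {x y : ℝ ≃o ℝ} (hx : x ∈ suspension hF K)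
    (hy : y ∈ suspension hF K) : x * y = y * x := by
  obtain ⟨u, hu, i, rfl⟩ := hx
  obtain ⟨v, hv, j, rfl⟩ := hy
  have huv : Commute u v := hK u hu v hv
  exact ((huv.map (equivariant hF)).mul_right ((equivariant_commute hF u).zpow_right j)).mul_left
    (((equivariant_commute hF v).zpow_right i).symm.mul_right ((Commute.refl F).zpow_zpow i j))

lemma floor_suspension (hF : IsStep F) (u : UnitAut) (i : ℤ) (x : ℝ) :
    ⌊(equivariant hF u * F ^ i) x⌋ = ⌊x⌋ + i := by
  rw [RelIso.mul_apply, floor_equivariant, hF.floor_zpow]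

/-- Elements of a suspension having a fixed point come from the group acting on `(0,1)`. -/
lemma exists_of_fixed (hF : IsStep F) {K : Subgroup UnitAut} {x : ℝ ≃o ℝ}
    (hx : x ∈ suspension hF K) {t : ℝ} (ht : x t = t) : ∃ u ∈ K, x = equivariant hF u := by
  obtain ⟨u, hu, i, rfl⟩ := hx
  have := floor_suspension hF u i t
  rw [ht] at this
  obtain rfl : i = 0 := by omega
  exact ⟨u, hu, by simp⟩

/-- The fixed points of the extension of a fixed point free map are integers. -/
lemma exists_int_of_fixed (hF : IsStep F) {u : UnitAut} (hu : ∀ y, u y ≠ y) {x : ℝ}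
    (hx : equivariant hF u x = x) : ∃ j : ℤ, x = j := by
  refine ⟨⌊x⌋, ?_⟩
  -- The extension commutes with `F`, so the fixed point can be moved into `[0,1)`; there only `0`
  -- can be fixed.
  have hc := ((equivariant_commute hF u).zpow_right (-⌊x⌋)).eq
  have h1 : equivariant hF u ((F ^ (-⌊x⌋)) x) = (F ^ (-⌊x⌋)) x := by
    have := DFunLike.congr_fun hc x
    rw [RelIso.mul_apply, RelIso.mul_apply, hx] at this
    exact this
  rcases mem_Ico_cases (hF.zpow_floor_mem x) with h | ⟨z, h⟩
  · have h2 := zpow_zpow_neg_apply F ⌊x⌋ x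
    have h3 := hF.zpow_apply ⌊x⌋ 0
    rw [h] at h2
    rw [Int.cast_zero, zero_add, h2] at h3
    exact h3
  · rw [h, equivariant_apply_unit] at h1
    exact (hu z (Subtype.ext h1)).elim

/-- `Ψ` conjugates `K` onto `L`. -/
def Conjugates {G : Type*} [Group G] (Ψ : G) (K L : Subgroup G) : Prop :=
  ∀ x, x ∈ K ↔ Ψ * x * Ψ⁻¹ ∈ L

lemma Conjugates.symm {G : Type*} [Group G] {Ψ : G} {K L : Subgroup G} (h : Conjugates Ψ K L) :
    Conjugates Ψ⁻¹ L K := by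
  intro x
  rw [h]
  simp [mul_assoc]

lemma Conjugates.mul_left {G : Type*} [Group G] {Ψ : G} {K L : Subgroup G}
    (h : Conjugates Ψ K L) {y : G} (hy : y ∈ L) : Conjugates (y * Ψ) K L := by
  intro x
  rw [h, show y * Ψ * x * (y * Ψ)⁻¹ = y * (Ψ * x * Ψ⁻¹) * y⁻¹ by group]
  rw [L.mul_mem_cancel_right (L.inv_mem hy), L.mul_mem_cancel_left hy]

/-- Pull the extension of a fixed point free `u` back by `Ψ`. The result lies in the other
suspension and fixes `Ψ⁻¹ 0`, so it involves no power of `F'` and fixes all integers. Hence the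
extension of `u` fixes `Ψ j`, and its fixed points are integers. -/
lemma Conjugates.exists_int (hF : IsStep F) (hF' : IsStep F') {K K' : Subgroup UnitAut}
    (hfree : ∃ u ∈ K, ∀ y, u y ≠ y) {Ψ : ℝ ≃o ℝ}
    (hΨ : Conjugates Ψ (suspension hF' K') (suspension hF K)) (j : ℤ) : ∃ i : ℤ, Ψ j = i := by
  obtain ⟨u, hu, hfp⟩ := hfree
  have h1 := (hΨ.symm _).1 (equivariant_mem_suspension hF hu)
  rw [inv_inv] at h1
  obtain ⟨v, hv, i, hvi⟩ := h1
  have h4 : equivariant hF u = Ψ * (equivariant hF' v * F' ^ i) * Ψ⁻¹ := by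
    rw [← hvi]; group
  have h3 : (Ψ⁻¹ * equivariant hF u * Ψ) (Ψ⁻¹ 0) = Ψ⁻¹ 0 := by
    simp only [RelIso.mul_apply, RelIso.apply_inv_self, equivariant_apply_zero]
  obtain ⟨v', -, hv'⟩ := exists_of_fixed hF' ⟨v, hv, i, hvi⟩ h3
  have h5 : equivariant hF u * Ψ = Ψ * equivariant hF' v' := by
    rw [← hv']; group
  apply exists_int_of_fixed hF hfp
  have := DFunLike.congr_fun h5 (j : ℝ)
  rwa [RelIso.mul_apply, RelIso.mul_apply, equivariant_apply_int] at this

lemma exists_unitAut {Ψ : ℝ ≃o ℝ} (h0 : Ψ 0 = 0) (h1 : Ψ 1 = 1) :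
    ∃ w : UnitAut, ∀ y : Ioo (0 : ℝ) 1, Ψ y = w y := by
  have hm : ∀ y : ℝ, y ∈ Ioo (0 : ℝ) 1 ↔ Ψ y ∈ Ioo (0 : ℝ) 1 := by
    intro y
    constructor
    · rintro ⟨h, h'⟩
      exact ⟨h0 ▸ Ψ.strictMono h, by simpa [h1] using Ψ.strictMono h'⟩
    · rintro ⟨h, h'⟩
      exact ⟨Ψ.lt_iff_lt.1 (by rwa [h0]), Ψ.lt_iff_lt.1 (by rwa [h1])⟩
  refine ⟨⟨Ψ.toEquiv.subtypeEquiv hm, ?_⟩, fun y => rfl⟩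
  intro a b
  exact Ψ.le_iff_le

/-- A conjugacy between suspensions of fixed point free abelian groups comes from a conjugacy of
these groups. -/
theorem Conjugates.of_suspension (hF : IsStep F) (hF' : IsStep F') {K K' : Subgroup UnitAut}
    (hfree : ∃ u ∈ K, ∀ y, u y ≠ y) (hfree' : ∃ u ∈ K', ∀ y, u y ≠ y)
    (hK : ∀ a ∈ K, ∀ b ∈ K, a * b = b * a) {Ψ : ℝ ≃o ℝ}
    (hΨ : Conjugates Ψ (suspension hF' K') (suspension hF K)) :
    ∃ w : UnitAut, ∃ γ ∈ K, Conjugates w K' K ∧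
      (∀ u ∈ K', Ψ * equivariant hF' u * Ψ⁻¹ = equivariant hF (w * u * w⁻¹)) ∧
      Ψ * F' * Ψ⁻¹ = equivariant hF γ * F := by
  obtain ⟨j, hj⟩ := hΨ.exists_int hF hF' hfree 0
  have hFj : F ^ (-j) ∈ suspension hF K := zpow_mem (step_mem_suspension hF K) _
  -- Normalize to `Ψ 0 = 0` by composing with a power of `F`. The suspension is abelian, so this
  -- changes no conjugate `Ψ x Ψ⁻¹`.
  suffices H : ∀ Φ : ℝ ≃o ℝ, Conjugates Φ (suspension hF' K') (suspension hF K) → Φ 0 = 0 →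
      ∃ w : UnitAut, ∃ γ ∈ K, Conjugates w K' K ∧
      (∀ u ∈ K', Φ * equivariant hF' u * Φ⁻¹ = equivariant hF (w * u * w⁻¹)) ∧
      Φ * F' * Φ⁻¹ = equivariant hF γ * F by
    obtain ⟨w, γ, hγ, h1, h2, h3⟩ := H (F ^ (-j) * Ψ) (hΨ.mul_left hFj) (by
      rw [RelIso.mul_apply]; simp only [Int.cast_zero] at hj; rw [hj, hF.zpow_apply]; simp)
    have key : ∀ x ∈ suspension hF' K',
        F ^ (-j) * Ψ * x * (F ^ (-j) * Ψ)⁻¹ = Ψ * x * Ψ⁻¹ := by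
      intro x hx
      rw [show F ^ (-j) * Ψ * x * (F ^ (-j) * Ψ)⁻¹ = F ^ (-j) * (Ψ * x * Ψ⁻¹) * (F ^ (-j))⁻¹ by
        group, suspension_comm hF hK hFj ((hΨ x).1 hx), mul_inv_cancel_right]
    refine ⟨w, γ, hγ, h1, fun u hu => ?_, ?_⟩
    · rw [← h2 u hu, key _ (equivariant_mem_suspension hF' hu)]
    · rw [← h3, key _ (step_mem_suspension hF' K')]
  clear hj hFj j hΨ Ψ
  intro Ψ hΨ h0
  -- `Ψ 1` and `Ψ⁻¹ 1` are both positive integers; by monotonicity both equal `1`.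
  have h1 : Ψ 1 = 1 := by
    obtain ⟨a, ha⟩ := hΨ.exists_int hF hF' hfree 1
    obtain ⟨b, hb⟩ := hΨ.symm.exists_int hF' hF hfree' 1
    simp only [Int.cast_one] at ha hb
    have hapos : 0 < a := by
      have := Ψ.strictMono zero_lt_one
      rw [h0, ha] at this; exact_mod_cast this
    have hb' : Ψ b = 1 := by rw [← hb, RelIso.apply_inv_self]
    have hbpos : 0 < b := by
      have : Ψ 0 < Ψ b := by rw [h0, hb']; exact zero_lt_one
      exact_mod_cast Ψ.lt_iff_lt.1 this
    have hle : Ψ 1 ≤ Ψ b := Ψ.monotone (by exact_mod_cast hbpos)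
    rw [ha, hb'] at hle
    have : a = 1 := le_antisymm (by exact_mod_cast hle) hapos
    rw [ha, this, Int.cast_one]
  obtain ⟨w, hw⟩ := exists_unitAut h0 h1
  have hwi : ∀ y : Ioo (0 : ℝ) 1, Ψ⁻¹ y = (w⁻¹ y : Ioo (0 : ℝ) 1) := by
    intro y
    apply Ψ.injective
    rw [RelIso.apply_inv_self, hw, RelIso.apply_inv_self]
  have h0i : Ψ⁻¹ 0 = 0 := by
    apply Ψ.injective; rw [RelIso.apply_inv_self, h0]
  have conj1 : ∀ u ∈ K', ∃ v ∈ K, Ψ * equivariant hF' u * Ψ⁻¹ = equivariant hF v := by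
    intro u hu
    refine exists_of_fixed hF ((hΨ _).1 (equivariant_mem_suspension hF' hu)) (t := 0) ?_
    simp [RelIso.mul_apply, h0i, h0, equivariant_apply_zero]
  have conj2 : ∀ u v, Ψ * equivariant hF' u * Ψ⁻¹ = equivariant hF v → w * u * w⁻¹ = v := by
    intro u v huv
    refine RelIso.ext fun y => Subtype.ext ?_
    have := DFunLike.congr_fun huv (y : ℝ)
    simp only [RelIso.mul_apply, hwi, equivariant_apply_unit, hw] at this
    exact this
  obtain ⟨γ, hγ, i, hγi⟩ := (hΨ _).1 (step_mem_suspension hF' K')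
  -- The exponent is read off from the floor of the image of `0`, which is `1`.
  have hi : i = 1 := by
    have h2 := floor_suspension hF γ i 0
    rw [← hγi] at h2
    have h3 := hF' 0
    simp only [Int.cast_zero, zero_add] at h3
    simp only [RelIso.mul_apply, h0i, h3, h1, Int.floor_one, Int.floor_zero, zero_add] at h2
    exact h2.symm
  subst hi
  refine ⟨w, γ, hγ, fun u => ⟨fun hu => ?_, fun hu => ?_⟩, fun u hu => ?_, ?_⟩
  · obtain ⟨v, hv, huv⟩ := conj1 u hu
    rw [conj2 u v huv]; exact hv
  · have h2 := (hΨ.symm _).1 (equivariant_mem_suspension hF hu)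
    obtain ⟨v, hv, huv⟩ := exists_of_fixed hF' h2 (t := 0)
      (by rw [inv_inv, RelIso.mul_apply, RelIso.mul_apply, h0, equivariant_apply_zero, h0i])
    have h3 := conj2 v _ (show Ψ * equivariant hF' v * Ψ⁻¹ = equivariant hF (w * u * w⁻¹) by
      rw [← huv]; group)
    rw [mul_left_inj, mul_right_inj] at h3
    exact h3 ▸ hv
  · obtain ⟨v, hv, huv⟩ := conj1 u hu
    rw [huv, conj2 u v huv]
  · rw [hγi, zpow_one]

/-- A conjugacy between abelian groups, followed by a change of the step by an element of the
group, is induced by a conjugacy of the suspensions. -/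
theorem exists_conj_suspension (hF : IsStep F) (hF' : IsStep F') {K K' : Subgroup UnitAut}
    (hK : ∀ a ∈ K, ∀ b ∈ K, a * b = b * a) {w : UnitAut} (hw : Conjugates w K' K) {γ : UnitAut}
    (hγ : γ ∈ K) :
    ∃ Ψ : ℝ ≃o ℝ, Ψ 0 = 0 ∧
      (∀ u ∈ K', Ψ * equivariant hF' u * Ψ⁻¹ = equivariant hF (w * u * w⁻¹)) ∧
      Ψ * F' * Ψ⁻¹ = equivariant hF γ * F := by
  -- Glue `w` from the step `F'` to the modified step `γF`. Elements of `K` commute with `γ`, so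
  -- their extensions with respect to `γF` and to `F` agree.
  refine ⟨glue hF' (hF.equivariant_mul γ) w, glue_apply_zero _ _ _, fun u hu => ?_,
    glue_conj_step _ _ _⟩
  rw [glue_conj_equivariant, equivariant_congr hF (hK _ ((hw u).1 hu) _ hγ)]

lemma conjugates_suspension (hF : IsStep F) (hF' : IsStep F') {K K' : Subgroup UnitAut}
    {w : UnitAut} (hw : Conjugates w K' K) {γ : UnitAut} (hγ : γ ∈ K) {Ψ : ℝ ≃o ℝ}
    (hE : ∀ u ∈ K', Ψ * equivariant hF' u * Ψ⁻¹ = equivariant hF (w * u * w⁻¹))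
    (hΨF : Ψ * F' * Ψ⁻¹ = equivariant hF γ * F) :
    Conjugates Ψ (suspension hF' K') (suspension hF K) := by
  have key : ∀ u ∈ K', ∀ i : ℤ, Ψ * (equivariant hF' u * F' ^ i) * Ψ⁻¹ =
      equivariant hF (w * u * w⁻¹ * γ ^ i) * F ^ i := by
    intro u hu i
    rw [show Ψ * (equivariant hF' u * F' ^ i) * Ψ⁻¹ =
      (Ψ * equivariant hF' u * Ψ⁻¹) * (Ψ * F' * Ψ⁻¹) ^ i by rw [conj_zpow]; group, hE u hu, hΨF,
      (equivariant_commute hF γ).mul_zpow, map_mul _ _ (γ ^ i), map_zpow]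
    simp only [mul_assoc]
  intro x
  constructor
  · rintro ⟨u, hu, i, rfl⟩
    rw [key u hu]
    exact ⟨_, mul_mem ((hw u).1 hu) (zpow_mem hγ i), i, rfl⟩
  · rintro ⟨v, hv, i, hx⟩
    -- This solves `w u w⁻¹ γ ^ i = v` for `u`.
    have hu : w⁻¹ * (v * γ ^ (-i)) * w ∈ K' := by
      simpa using (hw.symm _).1 (mul_mem hv (zpow_mem hγ (-i)))
    have h1 := key _ hu i
    rw [show w * (w⁻¹ * (v * γ ^ (-i)) * w) * w⁻¹ * γ ^ i = v by group, ← hx, mul_left_inj,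
      mul_right_inj] at h1
    exact ⟨_, hu, i, h1.symm⟩

end

/-! ### The groups acting on the line -/

/-- Conjugation by a homeomorphism from the line onto the unit interval. -/
def intervalConj (h : ℝ ≃ₜ Ioo (0 : ℝ) 1) : (ℝ ≃o ℝ) →* UnitAut where
  toFun σ := StrictMono.orderIsoOfRightInverse (fun a => h (σ (h.symm a)))
    (fun _ _ hab => conj_lt h σ hab) (fun a => h (σ⁻¹ (h.symm a))) fun a => by simp
  map_one' := RelIso.ext fun a => by
    change h ((1 : ℝ ≃o ℝ) (h.symm a)) = a
    simp
  map_mul' σ τ := RelIso.ext fun a => by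
    change h ((σ * τ) (h.symm a)) = h (σ (h.symm (h (τ (h.symm a)))))
    simp

lemma intervalConj_apply (h : ℝ ≃ₜ Ioo (0 : ℝ) 1) (σ : ℝ ≃o ℝ) (a : Ioo (0 : ℝ) 1) :
    intervalConj h σ a = h (σ (h.symm a)) := rfl

lemma intervalConj_injective (h : ℝ ≃ₜ Ioo (0 : ℝ) 1) : Function.Injective (intervalConj h) := by
  intro σ τ hst
  refine RelIso.ext fun t => h.injective ?_
  simpa [intervalConj_apply] using DFunLike.congr_fun hst (h t)

/-- The homeomorphism `h` may be decreasing; it then reverses the order twice. -/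
lemma strictMono_symm_conj (h : ℝ ≃ₜ Ioo (0 : ℝ) 1) (u : UnitAut) :
    StrictMono fun t => h.symm (u (h t)) := by
  have hc : Continuous fun t : ℝ => ((h t : Ioo (0 : ℝ) 1) : ℝ) :=
    continuous_subtype_val.comp h.continuous
  have hi : Function.Injective fun t : ℝ => ((h t : Ioo (0 : ℝ) 1) : ℝ) :=
    Subtype.val_injective.comp h.injective
  intro s t hst
  rcases hc.strictMono_of_inj hi with hm | hm
  · rw [← hm.lt_iff_lt]
    have h1 : h s < h t := hm hst
    simpa using u.strictMono h1
  · rw [← hm.lt_iff_gt]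
    have h1 : h t < h s := hm hst
    simpa using u.strictMono h1

lemma intervalConj_surjective (h : ℝ ≃ₜ Ioo (0 : ℝ) 1) :
    Function.Surjective (intervalConj h) := by
  intro u
  refine ⟨(strictMono_symm_conj h u).orderIsoOfRightInverse _ (fun t => h.symm (u⁻¹ (h t)))
    fun t => by simp, RelIso.ext fun a => ?_⟩
  change h (h.symm (u (h (h.symm a)))) = u a
  simp

/-- This identification makes `lift` a homomorphism and opens line groups to the results on
suspensions. -/
lemma lift_eq_equivariant (h : ℝ ≃ₜ Ioo (0 : ℝ) 1) (σ : ℝ ≃o ℝ) :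
    lift h σ = equivariant isStep_transl (intervalConj h σ) := by
  refine eq_glue isStep_transl isStep_transl _ ?_ ?_ fun y => ?_
  · change liftFun h σ 0 = 0
    simp [liftFun]
  · refine RelIso.ext fun x => ?_
    change liftFun h σ (x + 1) = liftFun h σ x + 1
    unfold liftFun
    simp only [Int.fract_add_one, Int.floor_add_one]
    split_ifs
    · push_cast; ring
    · rfl
  · change liftFun h σ y = _
    have hf : Int.fract (y : ℝ) = y := Int.fract_eq_self.2 ⟨y.2.1.le, y.2.2⟩
    have hfl : ⌊(y : ℝ)⌋ = 0 := Int.floor_eq_zero_iff.2 ⟨y.2.1.le, y.2.2⟩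
    unfold liftFun
    simp only [hf, hfl]
    rw [dif_pos y.2.1, Int.cast_zero, add_zero, intervalConj_apply]

/-- `lift` as a homomorphism. -/
def liftHom (h : ℝ ≃ₜ Ioo (0 : ℝ) 1) : (ℝ ≃o ℝ) →* (ℝ ≃o ℝ) :=
  (equivariant isStep_transl).comp (intervalConj h)

lemma liftHom_apply (h : ℝ ≃ₜ Ioo (0 : ℝ) 1) (σ : ℝ ≃o ℝ) : liftHom h σ = lift h σ :=
  (lift_eq_equivariant h σ).symm

lemma lift_commute (h : ℝ ≃ₜ Ioo (0 : ℝ) 1) (σ : ℝ ≃o ℝ) : Commute (lift h σ) (transl 1) := by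
  rw [lift_eq_equivariant]; exact equivariant_commute _ _

lemma transl_mul (a b : ℝ) : transl a * transl b = transl (a + b) := by
  refine RelIso.ext fun x => ?_
  change x + b + a = x + (a + b); ring

lemma transl_zero : transl 0 = 1 := RelIso.ext fun x => add_zero x

lemma transl_zpow (a : ℝ) (i : ℤ) : transl a ^ i = transl (i * a) := by
  let T : Multiplicative ℝ →* (ℝ ≃o ℝ) :=
    { toFun := fun a => transl a.toAdd
      map_one' := transl_zero
      map_mul' := fun a b => (transl_mul _ _).symm }
  have := (map_zpow T (Multiplicative.ofAdd a) i).symm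
  rw [← ofAdd_zsmul, zsmul_eq_mul] at this
  exact this

lemma transl_injective : Function.Injective transl := by
  intro a b hab
  have := DFunLike.congr_fun hab (0 : ℝ)
  change 0 + a = 0 + b at this
  simpa using this

lemma transl_mem_lineGroup (h : ℝ ≃ₜ Ioo (0 : ℝ) 1) (α : ℝ) (m : ℕ) :
    transl 1 ∈ lineGroup h α m := by
  cases m <;> exact Subgroup.subset_closure (by simp)

lemma mem_lineGroup_zero (h : ℝ ≃ₜ Ioo (0 : ℝ) 1) (α : ℝ) (σ : ℝ ≃o ℝ) :
    σ ∈ lineGroup h α 0 ↔ ∃ p q : ℤ, σ = transl (p + q * α) := by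
  constructor
  · intro hσ
    induction hσ using Subgroup.closure_induction with
    | mem x hx =>
      rcases hx with rfl | rfl
      · exact ⟨1, 0, by simp⟩
      · exact ⟨0, 1, by simp⟩
    | one => exact ⟨0, 0, by simp [transl_zero]⟩
    | mul x y _ _ hx hy =>
      obtain ⟨p, q, rfl⟩ := hx
      obtain ⟨p', q', rfl⟩ := hy
      exact ⟨p + p', q + q', by rw [transl_mul]; push_cast; congr 1; ring⟩
    | inv x _ hx =>
      obtain ⟨p, q, rfl⟩ := hx
      refine ⟨-p, -q, ?_⟩
      rw [← zpow_neg_one (transl _), transl_zpow]; push_cast; congr 1; ring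
  · rintro ⟨p, q, rfl⟩
    rw [← transl_mul, ← transl_zpow, ← mul_one (p : ℝ), ← transl_zpow]
    exact mul_mem (zpow_mem (Subgroup.subset_closure (by simp)) _)
      (zpow_mem (Subgroup.subset_closure (by simp)) _)

lemma lineGroup_succ (h : ℝ ≃ₜ Ioo (0 : ℝ) 1) (α : ℝ) (m : ℕ) :
    lineGroup h α (m + 1) = suspension isStep_transl ((lineGroup h α m).map (intervalConj h)) := by
  apply le_antisymm
  · refine (Subgroup.closure_le _).2 ?_
    rintro _ (⟨σ, hσ, rfl⟩ | rfl)
    · rw [lift_eq_equivariant]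
      exact equivariant_mem_suspension _ (Subgroup.mem_map_of_mem _ hσ)
    · exact step_mem_suspension _ _
  · rintro _ ⟨_, ⟨σ, hσ, rfl⟩, i, rfl⟩
    rw [← lift_eq_equivariant]
    exact mul_mem (Subgroup.subset_closure (Or.inl ⟨σ, hσ, rfl⟩))
      (zpow_mem (transl_mem_lineGroup h α (m + 1)) _)

lemma map_comm {G H : Type*} [Group G] [Group H] (f : G →* H) {K : Subgroup G}
    (hK : ∀ a ∈ K, ∀ b ∈ K, a * b = b * a) :
    ∀ a ∈ K.map f, ∀ b ∈ K.map f, a * b = b * a := by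
  rintro _ ⟨a, ha, rfl⟩ _ ⟨b, hb, rfl⟩
  rw [← map_mul, hK a ha b hb, map_mul]

lemma lineGroup_comm (h : ℝ ≃ₜ Ioo (0 : ℝ) 1) (α : ℝ) (m : ℕ) :
    ∀ a ∈ lineGroup h α m, ∀ b ∈ lineGroup h α m, a * b = b * a := by
  induction m with
  | zero =>
    intro a ha b hb
    obtain ⟨p, q, rfl⟩ := (mem_lineGroup_zero h α a).1 ha
    obtain ⟨p', q', rfl⟩ := (mem_lineGroup_zero h α b).1 hb
    rw [transl_mul, transl_mul, add_comm]
  | succ m ih =>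
    intro a ha b hb
    rw [lineGroup_succ] at ha hb
    exact suspension_comm _ (map_comm _ ih) ha hb

lemma lift_mem_lineGroup (h : ℝ ≃ₜ Ioo (0 : ℝ) 1) (α : ℝ) {m : ℕ} {σ : ℝ ≃o ℝ}
    (hσ : σ ∈ lineGroup h α m) : lift h σ ∈ lineGroup h α (m + 1) :=
  Subgroup.subset_closure (Or.inl ⟨σ, hσ, rfl⟩)

lemma exists_fixedPointFree (h c : ℝ ≃ₜ Ioo (0 : ℝ) 1) (α : ℝ) (m : ℕ) :
    ∃ u ∈ (lineGroup h α m).map (intervalConj c), ∀ y, u y ≠ y := by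
  refine ⟨_, Subgroup.mem_map_of_mem _ (transl_mem_lineGroup h α m), fun y hy => ?_⟩
  rw [intervalConj_apply, ← c.symm.injective.eq_iff, c.symm_apply_apply] at hy
  change c.symm y + 1 = c.symm y at hy
  linarith

/-! ### Coordinates -/

lemma ofCoords_zero (h : ℝ ≃ₜ Ioo (0 : ℝ) 1) (α : ℝ) (u : Fin 2 ⊕ Fin 0 → ℤ) :
    ofCoords h α 0 u = transl (u (Sum.inl 0) + u (Sum.inl 1) * α) := by
  simp [ofCoords, transl_zpow, transl_mul]

/-- The first coordinates of a vector. -/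
def initCoords {m : ℕ} (u : Fin 2 ⊕ Fin (m + 1) → ℤ) : Fin 2 ⊕ Fin m → ℤ :=
  u ∘ Sum.map id Fin.castSucc

/-- The recursion behind every induction on the rank: the last coordinate is the exponent of the
step `L₁`, and the others are coordinates in the suspended group. -/
lemma ofCoords_succ (h : ℝ ≃ₜ Ioo (0 : ℝ) 1) (α : ℝ) (m : ℕ) (u : Fin 2 ⊕ Fin (m + 1) → ℤ) :
    ofCoords h α (m + 1) u =
      lift h (ofCoords h α m (initCoords u)) * transl 1 ^ u (Sum.inr (Fin.last m)) := by
  rw [← liftHom_apply]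
  simp only [ofCoords, map_mul, map_zpow, map_list_prod, List.map_ofFn, liftHom_apply,
    ← Function.iterate_succ_apply' (lift h)]
  rw [List.ofFn_succ', List.concat_eq_append, List.prod_append, ← mul_assoc]
  congr 1
  · congr 1
    congr 1
    congr 1
    funext j
    simp only [Function.comp_apply, map_zpow, liftHom_apply, initCoords, Sum.map_inr,
      ← Function.iterate_succ_apply' (lift h)]
    congr 2
    have := j.2
    simp only [Fin.val_castSucc]
    omega
  · simp

lemma ofCoords_mem (h : ℝ ≃ₜ Ioo (0 : ℝ) 1) (α : ℝ) (m : ℕ) (u : Fin 2 ⊕ Fin m → ℤ) :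
    ofCoords h α m u ∈ lineGroup h α m := by
  induction m with
  | zero => rw [ofCoords_zero]; exact (mem_lineGroup_zero _ _ _).2 ⟨_, _, rfl⟩
  | succ m ih =>
    rw [ofCoords_succ]
    exact mul_mem (lift_mem_lineGroup h α (ih _)) (zpow_mem (transl_mem_lineGroup _ _ _) _)

lemma exists_ofCoords (h : ℝ ≃ₜ Ioo (0 : ℝ) 1) (α : ℝ) (m : ℕ) {σ : ℝ ≃o ℝ}
    (hσ : σ ∈ lineGroup h α m) : ∃ u, σ = ofCoords h α m u := by
  induction m generalizing σ with
  | zero =>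
    obtain ⟨p, q, rfl⟩ := (mem_lineGroup_zero _ _ _).1 hσ
    exact ⟨Sum.elim ![p, q] 0, by simp [ofCoords_zero]⟩
  | succ m ih =>
    rw [lineGroup_succ] at hσ
    obtain ⟨_, ⟨σ, hσ, rfl⟩, i, rfl⟩ := hσ
    obtain ⟨u, rfl⟩ := ih hσ
    refine ⟨Sum.elim (u ∘ Sum.inl) (Fin.snoc (u ∘ Sum.inr) i), ?_⟩
    rw [ofCoords_succ, ← lift_eq_equivariant]
    congr 3
    · funext x
      rcases x with x | x <;> simp [initCoords]
    · simp

lemma ofCoords_add (h : ℝ ≃ₜ Ioo (0 : ℝ) 1) (α : ℝ) (m : ℕ) (u v : Fin 2 ⊕ Fin m → ℤ) :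
    ofCoords h α m (u + v) = ofCoords h α m u * ofCoords h α m v := by
  induction m with
  | zero =>
    simp only [ofCoords_zero, transl_mul, Pi.add_apply]
    push_cast; congr 1; ring
  | succ m ih =>
    have hi : initCoords (u + v) = initCoords u + initCoords v := rfl
    simp only [ofCoords_succ, hi, ih, Pi.add_apply, zpow_add]
    rw [← liftHom_apply, map_mul, liftHom_apply, liftHom_apply, mul_assoc, mul_assoc,
      ← mul_assoc (lift h (ofCoords h α m (initCoords v))),
      ((lift_commute h _).zpow_right _).eq, mul_assoc]

/-- The coordinates as a homomorphism. -/
def coordsHom (h : ℝ ≃ₜ Ioo (0 : ℝ) 1) (α : ℝ) (m : ℕ) :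
    Multiplicative (Fin 2 ⊕ Fin m → ℤ) →* (ℝ ≃o ℝ) :=
  MonoidHom.mk' (fun u => ofCoords h α m u.toAdd) fun _ _ => ofCoords_add h α m _ _

lemma ofCoords_zsmul (h : ℝ ≃ₜ Ioo (0 : ℝ) 1) (α : ℝ) (m : ℕ) (i : ℤ) (u : Fin 2 ⊕ Fin m → ℤ) :
    ofCoords h α m (i • u) = ofCoords h α m u ^ i :=
  map_zpow (coordsHom h α m) (Multiplicative.ofAdd u) i

/-- The last column, without its bottom entry, is split off because it will be the coordinate vector
of the element `γ` by which the step changes. -/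
lemma initCoords_mulVec {m : ℕ} (A : Matrix (Fin 2) (Fin 2) ℤ) (C : Matrix (Fin 2) (Fin (m + 1)) ℤ)
    {B : Matrix (Fin (m + 1)) (Fin (m + 1)) ℤ}
    (u : Fin 2 ⊕ Fin (m + 1) → ℤ) :
    initCoords ((Matrix.fromBlocks A C 0 B).mulVec u) =
      (Matrix.fromBlocks A (C.submatrix id Fin.castSucc) 0
        (B.submatrix Fin.castSucc Fin.castSucc)).mulVec (initCoords u) +
      u (Sum.inr (Fin.last m)) •
        Sum.elim (fun i => C i (Fin.last m)) fun i => B i.castSucc (Fin.last m) := by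
  funext x
  rcases x with x | x <;>
  simp [initCoords, Matrix.mulVec, dotProduct, Fintype.sum_sum_type, Fin.sum_univ_castSucc] <;>
  ring

lemma mulVec_last {m : ℕ} (A : Matrix (Fin 2) (Fin 2) ℤ) (C : Matrix (Fin 2) (Fin (m + 1)) ℤ)
    {B : Matrix (Fin (m + 1)) (Fin (m + 1)) ℤ} (hB : B.BlockTriangular id) (hB1 : ∀ i, B i i = 1)
    (u : Fin 2 ⊕ Fin (m + 1) → ℤ) :
    (Matrix.fromBlocks A C 0 B).mulVec u (Sum.inr (Fin.last m)) = u (Sum.inr (Fin.last m)) := by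
  have hz : ∀ j : Fin m, B (Fin.last m) j.castSucc = 0 := fun j => hB (Fin.castSucc_lt_last j)
  simp [Matrix.mulVec, dotProduct, Fintype.sum_sum_type, Fin.sum_univ_castSucc, hz, hB1]

/-! ### Conjugacies of the groups acting on the line -/

lemma Conjugates.of_map {G H : Type*} [Group G] [Group H] {f : G →* H}
    (hf : Function.Injective f) {ψ : G} {K L : Subgroup G}
    (h : Conjugates (f ψ) (K.map f) (L.map f)) : Conjugates ψ K L := by
  intro x
  rw [← Subgroup.mem_map_iff_mem hf, h, ← map_inv, ← map_mul, ← map_mul,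
    Subgroup.mem_map_iff_mem hf]

lemma Conjugates.map {G H : Type*} [Group G] [Group H] {f : G →* H}
    {ψ : G} {K L : Subgroup G} (h : Conjugates ψ K L) :
    Conjugates (f ψ) (K.map f) (L.map f) := by
  intro x
  constructor
  · rintro ⟨x, hx, rfl⟩
    exact ⟨ψ * x * ψ⁻¹, (h x).1 hx, by simp⟩
  · rintro ⟨y, hy, hxy⟩
    refine ⟨ψ⁻¹ * y * ψ, by simpa using (h.symm y).1 hy, ?_⟩
    rw [map_mul, map_mul, hxy, map_inv]; group

/-- Rigidity of suspensions with step `L₁`, transported from `(0,1)` back to the line by `h`. -/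
lemma Conjugates.of_lineGroup_succ {h : ℝ ≃ₜ Ioo (0 : ℝ) 1} {α α' : ℝ} {m m' : ℕ} {Ψ : ℝ ≃o ℝ}
    (hΨ : Conjugates Ψ (lineGroup h α' (m' + 1)) (lineGroup h α (m + 1))) :
    ∃ ψ : ℝ ≃o ℝ, Conjugates ψ (lineGroup h α' m') (lineGroup h α m) ∧
      ∃ γ ∈ lineGroup h α m,
        (∀ σ ∈ lineGroup h α' m', Ψ * lift h σ * Ψ⁻¹ = lift h (ψ * σ * ψ⁻¹)) ∧
        Ψ * transl 1 * Ψ⁻¹ = lift h γ * transl 1 := by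
  rw [lineGroup_succ, lineGroup_succ] at hΨ
  obtain ⟨w, _, ⟨γ, hγ, rfl⟩, hw, h1, h2⟩ :=
    hΨ.of_suspension isStep_transl isStep_transl (exists_fixedPointFree h h α m)
      (exists_fixedPointFree h h α' m') (map_comm _ (lineGroup_comm h α m))
  obtain ⟨ψ, rfl⟩ := intervalConj_surjective h w
  refine ⟨ψ, hw.of_map (intervalConj_injective h), γ, hγ, fun σ hσ => ?_, ?_⟩
  · rw [lift_eq_equivariant, lift_eq_equivariant, h1 _ (Subgroup.mem_map_of_mem _ hσ)]
    simp
  · rw [lift_eq_equivariant, h2]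

/-- A nontrivial translation has no fixed point, whereas `lift h (transl 1)` is nontrivial and fixes
`0`. -/
lemma not_conjugates_zero_succ {h : ℝ ≃ₜ Ioo (0 : ℝ) 1} {α α' : ℝ} {m' : ℕ} {Ψ : ℝ ≃o ℝ}
    (hΨ : Conjugates Ψ (lineGroup h α' (m' + 1)) (lineGroup h α 0)) : False := by
  have h1 := (hΨ _).1 (lift_mem_lineGroup h α' (transl_mem_lineGroup h α' m'))
  obtain ⟨p, q, hpq⟩ := (mem_lineGroup_zero _ _ _).1 h1
  have h2 : lift h (transl 1) 0 = 0 := by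
    rw [lift_eq_equivariant]; exact equivariant_apply_zero _ _
  have h3 := DFunLike.congr_fun hpq (Ψ 0)
  simp only [RelIso.mul_apply, RelIso.inv_apply_self, h2] at h3
  have h4 : (p + q * α : ℝ) = 0 := by
    change Ψ 0 = Ψ 0 + (p + q * α) at h3
    linarith
  rw [h4, transl_zero, mul_inv_eq_iff_eq_mul, one_mul, mul_eq_left, lift_eq_equivariant,
    map_eq_one_iff _ (equivariant_injective _), map_eq_one_iff _ (intervalConj_injective h),
    ← transl_zero] at hpq
  exact one_ne_zero (transl_injective hpq)

lemma Conjugates.rank_eq {h : ℝ ≃ₜ Ioo (0 : ℝ) 1} {α α' : ℝ} {m m' : ℕ} {Ψ : ℝ ≃o ℝ}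
    (hΨ : Conjugates Ψ (lineGroup h α' m') (lineGroup h α m)) : m = m' := by
  induction m generalizing m' Ψ with
  | zero =>
    cases m' with
    | zero => rfl
    | succ m' => exact (not_conjugates_zero_succ hΨ).elim
  | succ m ih =>
    cases m' with
    | zero => exact (not_conjugates_zero_succ hΨ.symm).elim
    | succ m' =>
      obtain ⟨ψ, hψ, -⟩ := hΨ.of_lineGroup_succ
      rw [ih hψ]

/-! ### Translation groups, and matrices of conjugacies -/

lemma eq_of_add_mul_irrational {α : ℝ} (hα : Irrational α) {a b c d : ℤ}
    (h : (a : ℝ) + b * α = c + d * α) : a = c ∧ b = d := by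
  have hbd : b = d := by
    by_contra hne
    have hne' : ((d - b : ℤ) : ℝ) ≠ 0 := by
      exact_mod_cast sub_ne_zero.2 (Ne.symm hne)
    refine hα ⟨((a - c : ℤ) : ℚ) / ((d - b : ℤ) : ℚ), ?_⟩
    push_cast at hne' ⊢
    rw [div_eq_iff hne']
    linarith
  subst hbd
  exact ⟨by exact_mod_cast add_right_cancel h, rfl⟩

lemma transl_conj_pos {Ψ : ℝ ≃o ℝ} {a b : ℝ} (h : Ψ * transl a * Ψ⁻¹ = transl b) (ha : 0 < a) :
    0 < b := by
  have h1 := DFunLike.congr_fun h (Ψ 0)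
  simp only [RelIso.mul_apply, RelIso.inv_apply_self] at h1
  change Ψ (0 + a) = Ψ 0 + b at h1
  have : Ψ 0 < Ψ (0 + a) := Ψ.strictMono (by linarith)
  linarith

/-- An order preserving homomorphism on `ℤ + ℤ x` is a scaling. -/
lemma eq_mul_of_pos_imp_pos {x c d : ℝ} (hc : 0 < c)
    (H : ∀ p q : ℤ, 0 < p + q * x → 0 < p * c + q * d) : d = c * x := by
  rcases lt_trichotomy d (c * x) with hlt | heq | hgt
  -- For a rational `r` with `d / c < r < x`, the choice `p = -r.num`, `q = r.den` makes `p + q * x`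
  -- positive but `p * c + q * d` negative.
  · exfalso
    have h1 : d / c < x := by rw [div_lt_iff₀ hc]; linarith
    obtain ⟨r, hr1, hr2⟩ := exists_rat_btwn h1
    have hden : (0 : ℝ) < r.den := by exact_mod_cast r.den_pos
    have hr : (r : ℝ) = r.num / r.den := by exact_mod_cast (Rat.num_div_den r).symm
    rw [hr, div_lt_iff₀ hden] at hr2
    rw [hr, div_lt_div_iff₀ hc hden] at hr1
    have := H (-r.num) r.den (by push_cast; linarith)
    push_cast at this
    linarith
  · exact heq
  · exfalso
    have h1 : x < d / c := by rw [lt_div_iff₀ hc]; linarith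
    obtain ⟨r, hr1, hr2⟩ := exists_rat_btwn h1
    have hden : (0 : ℝ) < r.den := by exact_mod_cast r.den_pos
    have hr : (r : ℝ) = r.num / r.den := by exact_mod_cast (Rat.num_div_den r).symm
    rw [hr, lt_div_iff₀ hden] at hr1
    rw [hr, div_lt_div_iff₀ hden hc] at hr2
    have := H r.num (-r.den) (by push_cast; linarith)
    push_cast at this
    linarith

lemma conj_transl_comb {Ψ : ℝ ≃o ℝ} {x c d : ℝ} (hc : Ψ * transl 1 * Ψ⁻¹ = transl c)
    (hd : Ψ * transl x * Ψ⁻¹ = transl d) (p q : ℤ) :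
    Ψ * transl (p + q * x) * Ψ⁻¹ = transl (p * c + q * d) := by
  have hp : transl (p : ℝ) = transl 1 ^ p := by rw [transl_zpow, mul_one]
  rw [← transl_mul, ← transl_mul, ← transl_zpow, ← transl_zpow, ← transl_zpow, ← hc, ← hd, conj_zpow, conj_zpow,
    hp]
  group

lemma Conjugates.exists_moebius {h : ℝ ≃ₜ Ioo (0 : ℝ) 1} {α α' : ℝ} (hα : Irrational α)
    {Ψ : ℝ ≃o ℝ} (hΨ : Conjugates Ψ (lineGroup h α' 0) (lineGroup h α 0)) :
    ∃ A : GL (Fin 2) ℤ, MoebiusRel A α α' ∧ ∀ p q : ℤ, Ψ * transl (p + q * α') * Ψ⁻¹ =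
      transl ((A.1 0 0 * p + A.1 0 1 * q : ℤ) + (A.1 1 0 * p + A.1 1 1 * q : ℤ) * α) := by
  simp only [Conjugates, mem_lineGroup_zero] at hΨ
  obtain ⟨m₂, n₂, h1⟩ := (hΨ (transl 1)).1 ⟨1, 0, by simp⟩
  obtain ⟨m₁, n₁, h2⟩ := (hΨ (transl α')).1 ⟨0, 1, by simp⟩
  have hcomb := conj_transl_comb h1 h2
  have hc := transl_conj_pos h1 one_pos
  have hd := eq_mul_of_pos_imp_pos hc fun p q hpq => transl_conj_pos (hcomb p q) hpq
  -- Surjectivity of the conjugation, with coordinates compared by irrationality, gives an integral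
  -- right inverse of the matrix.
  have hinv : ∀ a b : ℤ, ∃ p q : ℤ, p * m₂ + q * m₁ = a ∧ p * n₂ + q * n₁ = b := by
    intro a b
    obtain ⟨p, q, hpq⟩ := (hΨ (Ψ⁻¹ * transl (a + b * α) * Ψ)).2 ⟨a, b, by group⟩
    have h3 := hcomb p q
    rw [← hpq, show Ψ * (Ψ⁻¹ * transl (a + b * α) * Ψ) * Ψ⁻¹ = transl (a + b * α) by group] at h3
    have h4 := transl_injective h3
    obtain ⟨h5, h6⟩ := eq_of_add_mul_irrational hα
      (show ((p * m₂ + q * m₁ : ℤ) : ℝ) + (p * n₂ + q * n₁ : ℤ) * α = a + b * α by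
        rw [h4]; push_cast; ring)
    exact ⟨p, q, h5, h6⟩
  obtain ⟨p₁, q₁, e1, e2⟩ := hinv 1 0
  obtain ⟨p₂, q₂, e3, e4⟩ := hinv 0 1
  have hAA : !![m₂, m₁; n₂, n₁] * !![p₁, p₂; q₁, q₂] = 1 := by
    rw [Matrix.mul_fin_two, Matrix.one_fin_two]
    congr 1
    simp only [mul_comm m₂, mul_comm m₁, mul_comm n₂, mul_comm n₁, e1, e2, e3, e4]
  refine ⟨⟨!![m₂, m₁; n₂, n₁], !![p₁, p₂; q₁, q₂], hAA, mul_eq_one_comm.1 hAA⟩,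
    ⟨by simpa using hc, ?_⟩, fun p q => ?_⟩
  · rw [eq_div_iff (by simpa using hc.ne')]
    simp only [Matrix.of_apply, Matrix.cons_val', Matrix.cons_val_zero, Matrix.cons_val_one,
      Matrix.cons_val_fin_one]
    linarith
  · rw [hcomb]
    congr 1
    simp only [Matrix.of_apply, Matrix.cons_val', Matrix.cons_val_zero, Matrix.cons_val_one,
      Matrix.cons_val_fin_one]
    push_cast; ring

/-- A conjugacy between the groups acting on the line acts on coordinates by a block matrix. -/
theorem Conjugates.exists_matrix {h : ℝ ≃ₜ Ioo (0 : ℝ) 1} {α α' : ℝ} (hα : Irrational α) {m : ℕ}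
    {Ψ : ℝ ≃o ℝ} (hΨ : Conjugates Ψ (lineGroup h α' m) (lineGroup h α m)) :
    ∃ (A : GL (Fin 2) ℤ) (C : Matrix (Fin 2) (Fin m) ℤ) (B : Matrix (Fin m) (Fin m) ℤ),
      MoebiusRel A α α' ∧ B.BlockTriangular id ∧ (∀ i, B i i = 1) ∧
      ∀ u, Ψ * ofCoords h α' m u * Ψ⁻¹ =
        ofCoords h α m ((Matrix.fromBlocks A.1 C 0 B).mulVec u) := by
  induction m generalizing Ψ with
  | zero =>
    obtain ⟨A, hA, hu⟩ := hΨ.exists_moebius hα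
    refine ⟨A, 0, 0, hA, fun i => i.elim0, fun i => i.elim0, fun u => ?_⟩
    rw [ofCoords_zero, hu, ofCoords_zero]
    congr 1
    simp [Matrix.mulVec, dotProduct, Fintype.sum_sum_type]
  | succ m ih =>
    obtain ⟨ψ, hψ, γ, hγ, h1, h2⟩ := hΨ.of_lineGroup_succ
    obtain ⟨A, C, B, hA, hB, hB1, hu⟩ := ih hψ
    obtain ⟨d, rfl⟩ := exists_ofCoords h α m hγ
    -- Append the coordinates `d` of `γ` as last column; the last row is the last unit vector, since
    -- `L₁` goes to `γ` lifted times `L₁`.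
    let C' : Matrix (Fin 2) (Fin (m + 1)) ℤ := fun i => Fin.snoc (C i) (d (Sum.inl i))
    let B' : Matrix (Fin (m + 1)) (Fin (m + 1)) ℤ :=
      Fin.snoc (fun i => Fin.snoc (B i) (d (Sum.inr i))) (Pi.single (Fin.last m) 1)
    have hC' : C'.submatrix id Fin.castSucc = C := by
      ext i j; change C' i j.castSucc = C i j; simp [C']
    have hB' : B'.submatrix Fin.castSucc Fin.castSucc = B := by
      ext i j; change B' i.castSucc j.castSucc = B i j; simp [B']
    have hd : (Sum.elim (fun i => C' i (Fin.last m)) fun i => B' i.castSucc (Fin.last m)) = d := by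
      funext x; rcases x with x | x <;> simp [C', B']
    have hBt : B'.BlockTriangular id := by
      intro i j hij
      simp only [id] at hij
      induction i using Fin.lastCases with
      | last => simp [B', hij.ne]
      | cast i =>
        induction j using Fin.lastCases with
        | last => exact absurd hij (not_lt.2 (Fin.le_last _))
        | cast j => simpa [B'] using hB (show id j < id i from Fin.castSucc_lt_castSucc_iff.1 hij)
    have hB1' : ∀ i, B' i i = 1 := by
      intro i
      induction i using Fin.lastCases with
      | last => simp [B']
      | cast i => simpa [B'] using hB1 i
    refine ⟨A, C', B', hA, hBt, hB1', fun u => ?_⟩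
    rw [ofCoords_succ, ofCoords_succ, mulVec_last _ _ hBt hB1', initCoords_mulVec, hC', hB', hd,
      ofCoords_add, ofCoords_zsmul, ← hu]
    set i := u (Sum.inr (Fin.last m))
    have h3 : Ψ * (lift h (ofCoords h α' m (initCoords u)) * transl 1 ^ i) * Ψ⁻¹ =
        (Ψ * lift h (ofCoords h α' m (initCoords u)) * Ψ⁻¹) * (Ψ * transl 1 * Ψ⁻¹) ^ i := by
      rw [conj_zpow]; group
    rw [h3, h1 _ (ofCoords_mem _ _ _ _), h2, (lift_commute h _).mul_zpow, ← mul_assoc]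
    simp only [← liftHom_apply, map_mul, map_zpow]

/-- The determinant of the block matrix is `det A`, a unit, so the action on coordinates is onto. -/
lemma conjugates_of_matrix {h : ℝ ≃ₜ Ioo (0 : ℝ) 1} {α α' : ℝ} {m : ℕ} {Ψ : ℝ ≃o ℝ}
    (A : GL (Fin 2) ℤ) (C : Matrix (Fin 2) (Fin m) ℤ) {B : Matrix (Fin m) (Fin m) ℤ}
    (hB : B.BlockTriangular id) (hB1 : ∀ i, B i i = 1)
    (hu : ∀ u, Ψ * ofCoords h α' m u * Ψ⁻¹ =
        ofCoords h α m ((Matrix.fromBlocks A.1 C 0 B).mulVec u)) :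
    Conjugates Ψ (lineGroup h α' m) (lineGroup h α m) := by
  have hdet : IsUnit (Matrix.fromBlocks A.1 C 0 B).det := by
    rw [Matrix.det_fromBlocks_zero₂₁, Matrix.det_of_isUpperTriangular hB]
    simp only [hB1, Finset.prod_const_one, mul_one]
    exact (Matrix.isUnit_iff_isUnit_det _).1 A.isUnit
  intro x
  constructor
  · intro hx
    obtain ⟨u, rfl⟩ := exists_ofCoords h α' m hx
    rw [hu]; exact ofCoords_mem _ _ _ _
  · intro hx
    obtain ⟨v, hv⟩ := exists_ofCoords h α m hx
    have h1 := hu ((Matrix.fromBlocks A.1 C 0 B)⁻¹.mulVec v)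
    rw [Matrix.mulVec_mulVec, Matrix.mul_nonsing_inv _ hdet, Matrix.one_mulVec, ← hv,
      mul_left_inj, mul_right_inj] at h1
    rw [← h1]; exact ofCoords_mem _ _ _ _

/-- Every admissible block matrix is induced by a conjugacy. -/
theorem exists_conj_of_matrix (h : ℝ ≃ₜ Ioo (0 : ℝ) 1) {α α' : ℝ} {m : ℕ}
    {A : GL (Fin 2) ℤ} (hA : MoebiusRel A α α') (C : Matrix (Fin 2) (Fin m) ℤ)
    {B : Matrix (Fin m) (Fin m) ℤ} (hB : B.BlockTriangular id) (hB1 : ∀ i, B i i = 1) :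
    ∃ Ψ : ℝ ≃o ℝ, ∀ u, Ψ * ofCoords h α' m u * Ψ⁻¹ =
        ofCoords h α m ((Matrix.fromBlocks A.1 C 0 B).mulVec u) := by
  induction m with
  | zero =>
    obtain ⟨hpos, hα'⟩ := hA
    -- The scaling by `m₂ + n₂ α` sends `L₁` and `L_α'` to translations by `m₂ + n₂ α` and `m₁ + n₁
    -- α`.
    refine ⟨OrderIso.mulLeft₀ _ hpos, fun u => ?_⟩
    rw [ofCoords_zero, ofCoords_zero, mul_inv_eq_iff_eq_mul]
    refine RelIso.ext fun x => ?_
    simp only [RelIso.mul_apply]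
    change ((A.1 0 0 : ℝ) + A.1 1 0 * α) * (x + (u (Sum.inl 0) + u (Sum.inl 1) * α')) =
      ((A.1 0 0 : ℝ) + A.1 1 0 * α) * x + ((((Matrix.fromBlocks A.1 C 0 B).mulVec u (Sum.inl 0) : ℤ) : ℝ) +
        ((Matrix.fromBlocks A.1 C 0 B).mulVec u (Sum.inl 1) : ℤ) * α)
    have key : ((A.1 0 0 : ℝ) + A.1 1 0 * α) * α' = A.1 0 1 + A.1 1 1 * α := by
      rw [hα', mul_div_cancel₀ _ hpos.ne']
    rw [mul_add, mul_add, mul_left_comm, key]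
    simp [Matrix.mulVec, dotProduct, Fintype.sum_sum_type]
    ring
  | succ m ih =>
    have hBt : (B.submatrix Fin.castSucc Fin.castSucc).BlockTriangular id :=
      fun i j hij => hB (show id j.castSucc < id i.castSucc from Fin.castSucc_lt_castSucc_iff.2 hij)
    have hBo : ∀ i, (B.submatrix Fin.castSucc Fin.castSucc) i i = 1 := fun i => hB1 _
    obtain ⟨ψ, hψ⟩ := ih (C.submatrix id Fin.castSucc) hBt hBo
    have hconj := conjugates_of_matrix A _ hBt hBo hψ
    set d : Fin 2 ⊕ Fin m → ℤ :=
      Sum.elim (fun i => C i (Fin.last m)) fun i => B i.castSucc (Fin.last m) with hd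
    -- The prescribed last column `d` is realized by changing the step by the element with
    -- coordinates `d`.
    obtain ⟨Ψ, -, h1, h2⟩ := exists_conj_suspension isStep_transl isStep_transl
      (map_comm (intervalConj h) (lineGroup_comm h α m)) hconj.map
      (Subgroup.mem_map_of_mem _ (ofCoords_mem h α m d))
    refine ⟨Ψ, fun u => ?_⟩
    rw [ofCoords_succ, ofCoords_succ, mulVec_last _ _ hB hB1, initCoords_mulVec, ← hd,
      ofCoords_add, ofCoords_zsmul, ← hψ]
    set i := u (Sum.inr (Fin.last m))
    have h3 : Ψ * (lift h (ofCoords h α' m (initCoords u)) * transl 1 ^ i) * Ψ⁻¹ =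
        (Ψ * lift h (ofCoords h α' m (initCoords u)) * Ψ⁻¹) * (Ψ * transl 1 * Ψ⁻¹) ^ i := by
      rw [conj_zpow]; group
    rw [h3, h2, lift_eq_equivariant h (ofCoords h α' m (initCoords u)),
      h1 _ (Subgroup.mem_map_of_mem _ (ofCoords_mem _ _ _ _)),
      (equivariant_commute isStep_transl _).mul_zpow, ← mul_assoc]
    simp only [lift_eq_equivariant, map_mul, map_zpow, map_inv]

/-! ### Lifts of homeomorphisms of the circle -/

/-- The covering of the circle by the line with deck transformations `x ↦ x + k i` which sends
`j - 1` to `x_j`. -/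
def proj (k : ℕ) (x : ℝ) : Circle := Circle.exp (2 * Real.pi * (x + 1) / k)

lemma proj_eq_iff {k : ℕ} (hk : 1 ≤ k) {x y : ℝ} :
    proj k x = proj k y ↔ ∃ i : ℤ, x = y + i * k := by
  have hk0 : (k : ℝ) ≠ 0 := by positivity
  rw [proj, proj, Circle.exp_eq_exp]
  refine exists_congr fun i => ?_
  have hpi := Real.pi_ne_zero
  constructor
  · intro h
    field_simp at h
    linarith
  · rintro rfl
    field_simp
    ring

lemma proj_add_mul {k : ℕ} (hk : 1 ≤ k) (x : ℝ) (i : ℤ) : proj k (x + i * k) = proj k x :=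
  (proj_eq_iff hk).2 ⟨i, rfl⟩

lemma proj_add {k : ℕ} (hk : 1 ≤ k) (x : ℝ) : proj k (x + k) = proj k x :=
  (proj_eq_iff hk).2 ⟨1, by simp⟩

lemma exp_eq_proj {k : ℕ} (hk : 1 ≤ k) (t : ℝ) :
    Circle.exp t = proj k (k * t / (2 * Real.pi) - 1) := by
  have hk0 : (k : ℝ) ≠ 0 := by positivity
  have hpi := Real.pi_ne_zero
  rw [proj]; congr 1; field_simp; ring

lemma pt_eq_proj (k j : ℕ) : pt k j = proj k (j - 1) := by
  rw [pt, proj, angle, sub_add_cancel]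

lemma continuous_proj (k : ℕ) : Continuous (proj k) := by
  unfold proj
  fun_prop

lemma proj_surjective {k : ℕ} (hk : 1 ≤ k) : Function.Surjective (proj k) := by
  intro z
  obtain ⟨t, rfl⟩ := Circle.exp_surjective z
  exact ⟨_, (exp_eq_proj hk t).symm⟩

lemma exists_proj_eq {k : ℕ} (hk : 1 ≤ k) (z : Circle) : ∃ x ∈ Ico (0 : ℝ) k, z = proj k x := by
  have hk0 : (0 : ℝ) < k := by positivity
  obtain ⟨x, rfl⟩ := proj_surjective hk z
  refine ⟨k * Int.fract (x / k), ⟨by positivity, ?_⟩, ?_⟩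
  · have := Int.fract_lt_one (x / k)
    nlinarith
  · rw [proj_eq_iff hk]
    refine ⟨⌊x / k⌋, ?_⟩
    rw [Int.fract]; field_simp; ring

lemma isQuotientMap_proj {k : ℕ} (hk : 1 ≤ k) : Topology.IsQuotientMap (proj k) := by
  refine IsOpenMap.isQuotientMap ?_ (continuous_proj k) (proj_surjective hk)
  have hk0 : (0 : ℝ) < k := by positivity
  have h1 : IsOpenMap fun x : ℝ => 2 * Real.pi * (x + 1) / k := by
    have h2 : (fun x : ℝ => 2 * Real.pi * (x + 1) / k) =
        (Homeomorph.mulLeft₀ (2 * Real.pi / k) (by positivity)) ∘ (Homeomorph.addRight (1 : ℝ)) := by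
      funext x
      simp only [Function.comp_apply, Homeomorph.coe_mulLeft₀, Homeomorph.coe_addRight]
      ring
    rw [h2]
    exact (Homeomorph.isOpenMap _).comp (Homeomorph.isOpenMap _)
  exact isLocalHomeomorph_circleExp.isOpenMap.comp h1

/-- `Ψ` is a lift of `ψ` to the line, seen as covering of the circle by `proj k` and `proj l`. -/
def IsLift (k l : ℕ) (Ψ : ℝ ≃o ℝ) (ψ : Circle ≃ₜ Circle) : Prop :=
  ∀ x, ψ (proj k x) = proj l (Ψ x)

section

variable {k l m : ℕ} {Ψ Φ : ℝ ≃o ℝ} {ψ τ : Circle ≃ₜ Circle}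

lemma IsLift.mul (h₂ : IsLift l m Φ τ) (h₁ : IsLift k l Ψ ψ) : IsLift k m (Φ * Ψ) (τ * ψ) := by
  intro x
  rw [Homeomorph.mul_apply, h₁, h₂]; rfl

lemma IsLift.inv (h : IsLift k l Ψ ψ) : IsLift l k Ψ⁻¹ ψ⁻¹ := by
  intro x
  apply ψ.injective
  rw [h, RelIso.apply_inv_self]
  exact ψ.apply_symm_apply _

lemma isLift_one : IsLift k k 1 1 := fun _ => rfl

lemma IsLift.pow (h : IsLift k k Ψ ψ) (i : ℕ) : IsLift k k (Ψ ^ i) (ψ ^ i) := by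
  induction i with
  | zero => exact isLift_one
  | succ i ih => rw [pow_succ, pow_succ]; exact ih.mul h

lemma IsLift.zpow (h : IsLift k k Ψ ψ) (i : ℤ) : IsLift k k (Ψ ^ i) (ψ ^ i) := by
  cases i with
  | ofNat i => simpa using h.pow i
  | negSucc i => rw [zpow_negSucc, zpow_negSucc]; exact (h.pow _).inv

lemma IsLift.unique (hk : 1 ≤ k) (h₁ : IsLift k l Ψ ψ) (h₂ : IsLift k l Ψ τ) : ψ = τ := by
  ext1 z
  obtain ⟨x, rfl⟩ := proj_surjective hk z
  rw [h₁, h₂]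

/-- A lift moves by a positive number `i` of periods. If `i > 1`, some `y` strictly between `x` and
`x + k` has `Ψ y = Ψ x + l`, against injectivity of `ψ`. -/
lemma IsLift.map_add (hk : 1 ≤ k) (hl : 1 ≤ l) (h : IsLift k l Ψ ψ) (x : ℝ) :
    Ψ (x + k) = Ψ x + l := by
  have hk0 : (0 : ℝ) < k := by positivity
  have hl0 : (0 : ℝ) < l := by positivity
  obtain ⟨i, hi⟩ := (proj_eq_iff hl).1
    (show proj l (Ψ (x + k)) = proj l (Ψ x) by rw [← h, ← h, proj_add hk])
  have hlt : Ψ x < Ψ (x + k) := Ψ.strictMono (by linarith)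
  have hi0 : 0 < i := by
    by_contra hc
    have : (i : ℝ) ≤ 0 := by exact_mod_cast not_lt.1 hc
    nlinarith
  rcases (Int.add_one_le_iff.2 hi0).eq_or_lt with h1 | h1
  · rw [hi, ← h1]; simp
  · exfalso
    have h2 : (1 : ℝ) < i := by exact_mod_cast h1
    obtain ⟨y, hy⟩ := Ψ.surjective (Ψ x + l)
    obtain ⟨j, hj⟩ := (proj_eq_iff hk).1 (show proj k y = proj k x by
      apply ψ.injective
      rw [h, h, hy, proj_add hl])
    have h3 : x < y := Ψ.lt_iff_lt.1 (by rw [hy]; linarith)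
    have h4 : y < x + k := Ψ.lt_iff_lt.1 (by rw [hy, hi]; nlinarith)
    have h5 : (0 : ℝ) < j := by
      by_contra hc
      nlinarith [not_lt.1 hc]
    have h6 : (j : ℝ) < 1 := by
      by_contra hc
      nlinarith [not_lt.1 hc]
    have h7 : 0 < j := by exact_mod_cast h5
    have h8 : j < 1 := by exact_mod_cast h6
    omega

lemma map_add_iff_conj {a b : ℝ} :
    (∀ x, Ψ (x + a) = Ψ x + b) ↔ Ψ * transl a * Ψ⁻¹ = transl b := by
  constructor
  · intro h
    rw [mul_inv_eq_iff_eq_mul]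
    exact RelIso.ext h
  · intro h x
    rw [mul_inv_eq_iff_eq_mul] at h
    exact DFunLike.congr_fun h x

lemma IsLift.conj_transl (hk : 1 ≤ k) (hl : 1 ≤ l) (h : IsLift k l Ψ ψ) :
    Ψ * transl k * Ψ⁻¹ = transl l := map_add_iff_conj.1 (h.map_add hk hl)

/-- The lifts of the identity are the deck transformations. -/
lemma IsLift.eq_transl_zpow (hk : 1 ≤ k) (h : IsLift k k Ψ 1) : ∃ i : ℤ, Ψ = transl k ^ i := by
  have hk0 : (0 : ℝ) < k := by positivity
  have hx : ∀ x, ∃ i : ℤ, Ψ x = x + i * k := fun x => (proj_eq_iff hk).1 (h x).symm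
  obtain ⟨i, hi⟩ := hx 0
  refine ⟨i, RelIso.ext fun x => ?_⟩
  rw [transl_zpow]
  change Ψ x = x + i * k
  have hshift : ∀ (j : ℤ) (y : ℝ), Ψ (y + j * k) = Ψ y + j * k := by
    intro j
    have := conj_zpow (a := Ψ) (b := transl k) (i := j)
    rw [h.conj_transl hk hk, transl_zpow] at this
    exact map_add_iff_conj.2 this.symm
  obtain ⟨i', hi'⟩ := hx x
  -- Move `x` to its representative `y` in `[0, k)`; monotonicity between `0` and `k` forces the
  -- shift at `y` to equal that at `0`.
  have h1 : x = k * Int.fract (x / k) + ⌊x / k⌋ * k := by rw [Int.fract]; field_simp; ring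
  set y := k * Int.fract (x / k) with hy
  have hy0 : 0 ≤ y := by positivity
  have hyk : y < k := by
    have := Int.fract_lt_one (x / k)
    nlinarith
  obtain ⟨j, hj⟩ := hx y
  have h2 := Ψ.monotone hy0
  have h3 := Ψ.strictMono hyk
  have h4 := hshift 1 0
  rw [Int.cast_one, one_mul, zero_add, hi] at h4
  rw [hi, hj] at h2
  rw [h4, hj] at h3
  have h5 : ((i - j : ℤ) : ℝ) < 1 := by push_cast; nlinarith
  have h6 : ((j - i : ℤ) : ℝ) < 1 := by push_cast; nlinarith
  have h7 : i - j < 1 := by exact_mod_cast h5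
  have h8 : j - i < 1 := by exact_mod_cast h6
  obtain rfl : i = j := by omega
  rw [h1, hshift, hj]; ring

/-- An orientation preserving homeomorphism of the circle has a lift. -/
lemma OrientationPreserving.exists_isLift (hψ : OrientationPreserving ψ) (hk : 1 ≤ k)
    (hl : 1 ≤ l) : ∃ Ψ, IsLift k l Ψ ψ := by
  obtain ⟨F, hFc, hFm, hF⟩ := hψ
  have hpi := Real.pi_pos
  have hk0 : (0 : ℝ) < k := by positivity
  have hl0 : (0 : ℝ) < l := by positivity
  -- Growth by at least `2π` per turn makes `F` unbounded in both directions, hence surjective by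
  -- continuity.
  have hstep : ∀ t, F t + 2 * Real.pi ≤ F (t + 2 * Real.pi) := by
    intro t
    obtain ⟨i, hi⟩ := Circle.exp_eq_exp.1
      (show Circle.exp (F (t + 2 * Real.pi)) = Circle.exp (F t) by
        rw [← hF, ← hF, Circle.exp_add_two_pi])
    have hlt : F t < F (t + 2 * Real.pi) := hFm (by linarith)
    have hi0 : 0 < i := by
      by_contra hc
      have : (i : ℝ) ≤ 0 := by exact_mod_cast not_lt.1 hc
      nlinarith
    have : (1 : ℝ) ≤ i := by exact_mod_cast hi0
    nlinarith
  have hstepn : ∀ (n : ℕ) t, F t + n * (2 * Real.pi) ≤ F (t + n * (2 * Real.pi)) := by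
    intro n
    induction n with
    | zero => simp
    | succ n ih =>
      intro t
      have h1 := ih t
      have h2 := hstep (t + n * (2 * Real.pi))
      rw [show t + ((n + 1 : ℕ) : ℝ) * (2 * Real.pi) =
        t + n * (2 * Real.pi) + 2 * Real.pi by push_cast; ring]
      push_cast; linarith
  have htop : Filter.Tendsto F Filter.atTop Filter.atTop := by
    refine Filter.tendsto_atTop_atTop_of_monotone hFm.monotone fun b => ?_
    obtain ⟨n, hn⟩ := exists_nat_ge (b - F 0)
    refine ⟨0 + n * (2 * Real.pi), le_trans ?_ (hstepn n 0)⟩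
    have : (n : ℝ) ≤ n * (2 * Real.pi) := by
      nlinarith [Real.pi_gt_three, (Nat.cast_nonneg n : (0 : ℝ) ≤ n)]
    linarith
  have hbot : Filter.Tendsto F Filter.atBot Filter.atBot := by
    refine Filter.tendsto_atBot_atBot_of_monotone hFm.monotone fun b => ?_
    obtain ⟨n, hn⟩ := exists_nat_ge (F 0 - b)
    refine ⟨-(n * (2 * Real.pi)), ?_⟩
    have h1 := hstepn n (-(n * (2 * Real.pi)))
    rw [neg_add_cancel] at h1
    have : (n : ℝ) ≤ n * (2 * Real.pi) := by
      nlinarith [Real.pi_gt_three, (Nat.cast_nonneg n : (0 : ℝ) ≤ n)]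
    linarith
  have hsurj := hFc.surjective htop hbot
  have hmono : StrictMono fun x : ℝ => l * F (2 * Real.pi * (x + 1) / k) / (2 * Real.pi) - 1 := by
    intro x y hxy
    have h1 : 2 * Real.pi * (x + 1) / k < 2 * Real.pi * (y + 1) / k := by gcongr
    have h2 := hFm h1
    dsimp only
    gcongr
  refine ⟨StrictMono.orderIsoOfSurjective _ hmono fun y => ?_, fun x => ?_⟩
  · obtain ⟨t, ht⟩ := hsurj (2 * Real.pi * (y + 1) / l)
    refine ⟨k * t / (2 * Real.pi) - 1, ?_⟩
    have : 2 * Real.pi * (k * t / (2 * Real.pi) - 1 + 1) / k = t := by field_simp; ring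
    simp only [this, ht]
    field_simp; ring
  · rw [proj, hF, exp_eq_proj hl]; rfl

/-- An increasing map of the line commuting with deck transformations descends to the circle. -/
lemma exists_descent (hk : 1 ≤ k) (hl : 1 ≤ l) (h : Ψ * transl k * Ψ⁻¹ = transl l) :
    ∃ ψ, OrientationPreserving ψ ∧ IsLift k l Ψ ψ := by
  have hpi := Real.pi_pos
  have hk0 : (0 : ℝ) < k := by positivity
  have hl0 : (0 : ℝ) < l := by positivity
  have hwd : ∀ {k l : ℕ} {Ψ : ℝ ≃o ℝ} (hk : 1 ≤ k) (hl : 1 ≤ l)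
      (h : Ψ * transl k * Ψ⁻¹ = transl l), ∃ d : Circle → Circle, Continuous d ∧
      ∀ x, d (proj k x) = proj l (Ψ x) := by
    intro k l Ψ hk hl h
    have hd : ∀ x, proj l (Ψ (Function.surjInv (proj_surjective hk) (proj k x))) =
        proj l (Ψ x) := by
      intro x
      obtain ⟨i, hi⟩ := (proj_eq_iff hk).1 (Function.surjInv_eq (proj_surjective hk) (proj k x))
      have h1 := conj_zpow (a := Ψ) (b := transl k) (i := i)
      rw [h, transl_zpow, transl_zpow] at h1
      rw [hi, map_add_iff_conj.2 h1.symm, proj_add_mul hl]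
    refine ⟨fun z => proj l (Ψ (Function.surjInv (proj_surjective hk) z)), ?_, hd⟩
    rw [(isQuotientMap_proj hk).continuous_iff]
    exact ((continuous_proj l).comp Ψ.continuous).congr fun x => (hd x).symm
  obtain ⟨d, hdc, hd⟩ := hwd hk hl h
  obtain ⟨e, hec, he⟩ := hwd (Ψ := Ψ⁻¹) hl hk (by rw [← h]; group)
  refine ⟨⟨⟨d, e, fun z => ?_, fun z => ?_⟩, hdc, hec⟩, ?_, hd⟩
  · obtain ⟨x, rfl⟩ := proj_surjective hk z
    rw [hd, he, RelIso.inv_apply_self]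
  · obtain ⟨x, rfl⟩ := proj_surjective hl z
    rw [he, hd, RelIso.apply_inv_self]
  · refine ⟨fun t => 2 * Real.pi * (Ψ (k * t / (2 * Real.pi) - 1) + 1) / l, ?_, ?_, fun t => ?_⟩
    · have := Ψ.continuous
      fun_prop
    · intro s t hst
      have h1 : k * s / (2 * Real.pi) - 1 < k * t / (2 * Real.pi) - 1 := by gcongr
      have h2 := Ψ.strictMono h1
      dsimp only
      gcongr
    · change d (Circle.exp t) = _
      rw [exp_eq_proj hk, hd]; rfl

end

/-! ### The groups acting on the circle -/

/-- The chart of an arc, read on the unit interval. -/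
def unitChart {k : ℕ} (hk : 1 ≤ k) (φ : ArcChart k) : ℝ ≃o Ioo (0 : ℝ) 1 :=
  have hpi := Real.pi_pos
  have hk0 : (0 : ℝ) < k := by positivity
  StrictMono.orderIsoOfRightInverse
    (fun t => ⟨k * (φ t : ℝ) / (2 * Real.pi) - 1, by
      obtain ⟨h1, h2⟩ := (φ t).2
      replace h1 := (div_lt_iff₀ hk0).1 h1
      replace h2 := (lt_div_iff₀ hk0).1 h2
      push_cast at h1 h2
      constructor
      · rw [sub_pos, lt_div_iff₀ (by positivity)]; linarith
      · rw [sub_lt_iff_lt_add, div_lt_iff₀ (by positivity)]; linarith⟩)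
    (fun s t hst => by
      have h1 : (φ s : ℝ) < φ t := φ.strictMono hst
      rw [Subtype.mk_lt_mk]
      gcongr)
    (fun y => φ.symm ⟨2 * Real.pi * (y + 1) / k, by
      obtain ⟨h1, h2⟩ := y.2
      simp only [angle]
      push_cast
      constructor <;> gcongr <;> linarith⟩)
    fun y => by
      refine Subtype.ext ?_
      simp only [OrderIso.apply_symm_apply]
      field_simp
      ring

lemma proj_unitChart {k : ℕ} (hk : 1 ≤ k) (φ : ArcChart k) (t : ℝ) :
    proj k (unitChart hk φ t) = φ.toCircle t :=
  (exp_eq_proj hk _).symm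

/-- Conjugation by the chart of an arc. -/
def arcConj {k : ℕ} (hk : 1 ≤ k) (φ : ArcChart k) : (ℝ ≃o ℝ) →* UnitAut :=
  intervalConj (unitChart hk φ).toHomeomorph

lemma arcConj_apply {k : ℕ} (hk : 1 ≤ k) (φ : ArcChart k) (σ : ℝ ≃o ℝ) (t : ℝ) :
    arcConj hk φ σ (unitChart hk φ t) = unitChart hk φ (σ t) := by
  change unitChart hk φ (σ ((unitChart hk φ).symm (unitChart hk φ t))) = _
  rw [OrderIso.symm_apply_apply]

/-- Two charts differ by a bijection of the unit interval, which is why `φ` and `φ'` may be chosen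
independently. -/
lemma exists_arcConj_eq {k l : ℕ} (hk : 1 ≤ k) (hl : 1 ≤ l) (φ : ArcChart k) (φ' : ArcChart l) :
    ∃ e : UnitAut, ∀ σ, arcConj hk φ σ = e * arcConj hl φ' σ * e⁻¹ := by
  refine ⟨(unitChart hl φ').symm.trans (unitChart hk φ), fun σ => ?_⟩
  rw [eq_mul_inv_iff_mul_eq]
  refine RelIso.ext fun y => ?_
  obtain ⟨t, rfl⟩ := (unitChart hl φ').surjective y
  simp only [RelIso.mul_apply, arcConj_apply]
  change arcConj hk φ σ (unitChart hk φ ((unitChart hl φ').symm (unitChart hl φ' t))) =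
    unitChart hk φ ((unitChart hl φ').symm (unitChart hl φ' (σ t)))
  rw [OrderIso.symm_apply_apply, OrderIso.symm_apply_apply, arcConj_apply]

lemma root_proj_int {k : ℕ} (hk : 1 ≤ k) {φ : ArcChart k} {g : ℝ ≃o ℝ} {f : Circle ≃ₜ Circle}
    (hf : IsRoot φ g f) (j : ℤ) : f (proj k j) = proj k (j + 1) := by
  -- Adding `|j|` full turns makes the index of the marked point a natural number.
  have hn : 0 ≤ j + 1 + |j| * k := by
    have h1 : (1 : ℤ) ≤ k := by exact_mod_cast hk
    have h2 := neg_abs_le j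
    have h3 := abs_nonneg j
    nlinarith
  obtain ⟨n, hn'⟩ := Int.eq_ofNat_of_zero_le hn
  have hnr : (n : ℝ) = j + 1 + (|j| : ℤ) * k := by exact_mod_cast hn'.symm
  have h1 := hf.map_pt n
  rw [pt_eq_proj, pt_eq_proj, Nat.cast_add, Nat.cast_one, hnr,
    show (j : ℝ) + 1 + (|j| : ℤ) * k - 1 = j + (|j| : ℤ) * k by ring,
    show (j : ℝ) + 1 + (|j| : ℤ) * k + 1 - 1 = j + 1 + (|j| : ℤ) * k by ring,
    proj_add_mul hk, proj_add_mul hk] at h1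
  exact h1

/-- A monotone periodic perturbation of the identity of the integers is a translation. -/
lemma int_eq_add_of_strictMono {N : ℤ → ℤ} (hN : StrictMono N) {k : ℕ} (hk : 1 ≤ k)
    (hp : ∀ j, N (j + k) = N j + k) (j : ℤ) : N j = N 0 + j := by
  -- `N j - j` is monotone and periodic, hence constant.
  have hm : Monotone fun j => N j - j := by
    refine monotone_int_of_le_succ fun j => ?_
    have := hN (show j < j + 1 by omega)
    omega
  have hper : Function.Periodic (fun j => N j - j) (k : ℤ) := by
    intro j
    simp only [hp]; ring
  have hk1 : (1 : ℤ) ≤ k := by exact_mod_cast hk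
  have h0 : N (j * k) - j * k = N 0 - 0 := hper.int_mul_eq j
  have h0' : N (-(|j|) * k) - (-(|j|) * k) = N 0 - 0 := hper.int_mul_eq _
  have h1' : N (|j| * k) - (|j| * k) = N 0 - 0 := hper.int_mul_eq _
  have hj := abs_nonneg j
  have h2 : N (-(|j|) * k) - (-(|j|) * k) ≤ N j - j :=
    hm (show -(|j|) * (k : ℤ) ≤ j by nlinarith [neg_abs_le j])
  have h3 : N j - j ≤ N (|j| * k) - (|j| * k) :=
    hm (show j ≤ |j| * (k : ℤ) by nlinarith [le_abs_self j])
  omega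

/-- The lift of a root normalized by sending `0` to `1`. -/
lemma IsRoot.exists_lift {k : ℕ} (hk : 1 ≤ k) {φ : ArcChart k} {g : ℝ ≃o ℝ}
    {f : Circle ≃ₜ Circle} (hf : IsRoot φ g f) :
    ∃ (F : ℝ ≃o ℝ) (hF : IsStep F), IsLift k k F f ∧
      F ^ k = equivariant hF (arcConj hk φ g) * transl k := by
  have hk0 : (0 : ℝ) < k := by positivity
  obtain ⟨F₁, hF₁⟩ := hf.orientationPreserving.exists_isLift hk hk
  have hint : ∀ j : ℤ, ∃ i : ℤ, F₁ j = j + 1 + i * k := fun j =>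
    (proj_eq_iff hk).1 ((hF₁ j).symm.trans (root_proj_int hk hf j))
  choose N hN using hint
  have hstep : ∀ j : ℤ, F₁ j = j + (1 + N 0 * k) := by
    have hN' : ∀ j : ℤ, F₁ j = ((j + 1 + N j * k : ℤ) : ℝ) := fun j => by
      rw [hN]; push_cast; ring
    have h1 := int_eq_add_of_strictMono (N := fun j => j + 1 + N j * k) (fun i j hij => by
        have : F₁ i < F₁ j := F₁.strictMono (by exact_mod_cast hij)
        rw [hN', hN'] at this
        exact_mod_cast this) hk (fun j => by
        have := hF₁.map_add hk hk j
        rw [show (j : ℝ) + k = ((j + k : ℤ) : ℝ) by push_cast; ring, hN', hN'] at this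
        exact_mod_cast this)
    intro j
    rw [hN', h1 j]; push_cast; ring
  -- The deck transformation that corrects the arbitrary lift so that `0` goes to `1`.
  have htr : IsLift k k (transl k ^ (-N 0)) 1 := by
    intro x
    rw [transl_zpow]
    exact (proj_add_mul hk x (-N 0)).symm
  have hF : IsStep (transl k ^ (-N 0) * F₁) := by
    intro j
    rw [RelIso.mul_apply, hstep, transl_zpow]
    change (j : ℝ) + (1 + N 0 * k) + (-N 0 : ℤ) * k = j + 1
    push_cast; ring
  have hlift : IsLift k k (transl k ^ (-N 0) * F₁) f := by simpa using htr.mul hF₁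
  set F := transl k ^ (-N 0) * F₁
  refine ⟨F, hF, hlift, ?_⟩
  have hcF : Commute F (transl k) := by
    have := hlift.conj_transl hk hk
    rwa [mul_inv_eq_iff_eq_mul] at this
  rw [← mul_inv_eq_iff_eq_mul]
  refine eq_glue hF hF _ ?_ ?_ fun y => ?_
  · have h1 := hF.zpow_apply k (-k)
    rw [RelIso.mul_apply, ← zpow_neg_one (transl (k : ℝ)), transl_zpow]
    change (F ^ k) (0 + (-1 : ℤ) * k) = 0
    rw [zpow_natCast] at h1
    push_cast at h1 ⊢
    rw [zero_add, neg_one_mul, h1]; ring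
  · exact (((Commute.refl F).pow_left k).mul_left hcF.symm.inv_left).eq
  · obtain ⟨t, rfl⟩ := (unitChart hk φ).surjective y
    rw [arcConj_apply, (hcF.pow_left k).inv_right.eq, ← zpow_neg_one (transl (k : ℝ)), transl_zpow]
    change (F ^ k) _ + (-1 : ℤ) * (k : ℝ) = _
    have h1 := hf.pow_eq t
    rw [← proj_unitChart hk, ← proj_unitChart hk, hlift.pow k] at h1
    obtain ⟨i, hi⟩ := (proj_eq_iff hk).1 h1
    -- `pow_eq` determines `F ^ k` only up to a deck transformation; comparing floors shows that it
    -- is exactly one turn.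
    have h2 := hF.floor_zpow k (unitChart hk φ t)
    rw [zpow_natCast, hi, show (i : ℝ) * k = ((i * k : ℤ) : ℝ) by push_cast; ring,
      Int.floor_add_intCast, Int.floor_eq_zero_iff.2 ⟨(unitChart hk φ t).2.1.le,
        (unitChart hk φ t).2.2⟩, Int.floor_eq_zero_iff.2 ⟨(unitChart hk φ (g t)).2.1.le,
        (unitChart hk φ (g t)).2.2⟩, zero_add, zero_add] at h2
    have h3 : (i : ℝ) * k = k := by exact_mod_cast h2
    rw [hi, h3]; push_cast; ring

section

variable {k : ℕ} {φ : ArcChart k} {g F σ : ℝ ≃o ℝ} {f τ : Circle ≃ₜ Circle}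

lemma isExtension_of_isLift (hk : 1 ≤ k) (hF : IsStep F) (hFf : IsLift k k F f)
    (hτ : IsLift k k (equivariant hF (arcConj hk φ σ)) τ) : IsExtension φ f σ τ := by
  refine ⟨fun j => ?_, fun i _ t => ?_⟩
  · rw [pt_eq_proj, hτ]
    have := equivariant_apply_int hF (arcConj hk φ σ) (j - 1)
    push_cast at this
    rw [this]
  · have h1 := ((equivariant_commute hF (arcConj hk φ σ)).pow_right i).eq
    have h2 := DFunLike.congr_fun h1 (unitChart hk φ t : ℝ)
    simp only [RelIso.mul_apply, equivariant_apply_unit, arcConj_apply] at h2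
    rw [← proj_unitChart hk, ← proj_unitChart hk, hFf.pow, hFf.pow, hτ, h2]

/-- The circle is the union of the arcs `f^i (x₁, x₂)`, `i < k`, and the points `x_j`, where the
values are prescribed. -/
lemma IsExtension.unique (hk : 1 ≤ k) (hF : IsStep F) (hFf : IsLift k k F f)
    {τ' : Circle ≃ₜ Circle} (hτ : IsExtension φ f σ τ) (hτ' : IsExtension φ f σ τ') : τ = τ' := by
  ext1 z
  obtain ⟨x, ⟨hx0, hxk⟩, rfl⟩ := exists_proj_eq hk z
  obtain ⟨i, hi⟩ := Int.eq_ofNat_of_zero_le (Int.floor_nonneg.2 hx0)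
  have hik : i < k := by
    have := Int.floor_le x
    rw [hi] at this
    have : (i : ℝ) < k := lt_of_le_of_lt (by exact_mod_cast this) hxk
    exact_mod_cast this
  have h1 := zpow_zpow_neg_apply F ⌊x⌋ x
  rcases mem_Ico_cases (hF.zpow_floor_mem x) with h | ⟨y, h⟩
  · have h2 := hF.zpow_apply i 0
    rw [h, hi] at h1
    simp only [Int.cast_zero, zero_add, Int.cast_natCast] at h2
    have h3 : proj k x = pt k (i + 1) := by
      rw [pt_eq_proj, ← h1]; push_cast; rw [add_sub_cancel_right, ← h2]
    rw [h3, hτ.1, hτ'.1]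
  · obtain ⟨t, rfl⟩ := (unitChart hk φ).surjective y
    rw [h, hi] at h1
    have h3 : proj k x = (f ^ i) (φ.toCircle t) := by
      rw [← proj_unitChart hk, hFf.pow, ← h1]; simp
    rw [h3, hτ.2 i hik, hτ'.2 i hik]

variable {G : Subgroup (ℝ ≃o ℝ)}

/-- The element by which the deck transformation is given in the suspension. -/
lemma transl_mem_suspension (hk : 1 ≤ k) (hF : IsStep F) (hg : g ∈ G)
    (hFk : F ^ k = equivariant hF (arcConj hk φ g) * transl k) :
    transl k ∈ suspension hF (G.map (arcConj hk φ)) := by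
  rw [← inv_mul_eq_iff_eq_mul] at hFk
  rw [← hFk]
  exact mul_mem (inv_mem (equivariant_mem_suspension hF (Subgroup.mem_map_of_mem _ hg)))
    (pow_mem (step_mem_suspension hF _) _)

/-- The deck transformation lies in the suspension, which is abelian, so every element commutes with
it and descends. -/
lemma exists_descent_of_mem (hk : 1 ≤ k) (hF : IsStep F) (hg : g ∈ G)
    (hG : ∀ a ∈ G, ∀ b ∈ G, a * b = b * a)
    (hFk : F ^ k = equivariant hF (arcConj hk φ g) * transl k) {x : ℝ ≃o ℝ}
    (hx : x ∈ suspension hF (G.map (arcConj hk φ))) : ∃ τ, IsLift k k x τ := by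
  obtain ⟨τ, -, hτ⟩ := exists_descent (Ψ := x) hk hk (by
    rw [suspension_comm hF (map_comm _ hG) hx (transl_mem_suspension hk hF hg hFk),
      mul_inv_cancel_right])
  exact ⟨τ, hτ⟩

/-- `S` is the group of all lifts of the elements of `H`. -/
structure IsPreimage (k : ℕ) (H : Subgroup (Circle ≃ₜ Circle)) (S : Subgroup (ℝ ≃o ℝ)) : Prop where
  descend : ∀ x ∈ S, ∃ τ ∈ H, IsLift k k x τ
  lift : ∀ τ ∈ H, ∃ x ∈ S, IsLift k k x τ
  transl_mem : transl k ∈ S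

lemma IsPreimage.mem_iff (hk : 1 ≤ k) {H : Subgroup (Circle ≃ₜ Circle)} {S : Subgroup (ℝ ≃o ℝ)}
    (h : IsPreimage k H S) {x : ℝ ≃o ℝ} (hx : IsLift k k x τ) : τ ∈ H ↔ x ∈ S := by
  constructor
  · intro hτ
    obtain ⟨y, hy, hyτ⟩ := h.lift τ hτ
    have h2 := hyτ.inv.mul hx
    rw [inv_mul_cancel] at h2
    obtain ⟨i, hi⟩ := h2.eq_transl_zpow hk
    rw [inv_mul_eq_iff_eq_mul] at hi
    rw [hi]
    exact mul_mem hy (zpow_mem h.transl_mem _)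
  · intro hxS
    obtain ⟨τ', hτ', hxτ'⟩ := h.descend x hxS
    rwa [hx.unique hk hxτ']

/-- The preimage in the line of the group generated by a root and the extensions. -/
lemma isPreimage_closure (hk : 1 ≤ k) (hF : IsStep F) (hFf : IsLift k k F f)
    (hg : g ∈ G) (hG : ∀ a ∈ G, ∀ b ∈ G, a * b = b * a)
    (hFk : F ^ k = equivariant hF (arcConj hk φ g) * transl k) :
    IsPreimage k (Subgroup.closure ({τ | ∃ σ ∈ G, IsExtension φ f σ τ} ∪ {f}))
      (suspension hF (G.map (arcConj hk φ))) where
  descend := by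
    rintro _ ⟨_, ⟨σ, hσ, rfl⟩, i, rfl⟩
    obtain ⟨τ, hτ⟩ := exists_descent_of_mem hk hF hg hG hFk
      (equivariant_mem_suspension hF (Subgroup.mem_map_of_mem (arcConj hk φ) hσ))
    have hf : f ∈ Subgroup.closure ({τ | ∃ σ ∈ G, IsExtension φ f σ τ} ∪ {f}) :=
      Subgroup.subset_closure (Or.inr rfl)
    exact ⟨τ * f ^ i, mul_mem
      (Subgroup.subset_closure (Or.inl ⟨σ, hσ, isExtension_of_isLift hk hF hFf hτ⟩))
      (zpow_mem hf i), hτ.mul (hFf.zpow i)⟩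
  lift := by
    intro τ hτ
    induction hτ using Subgroup.closure_induction with
    | mem τ hτ =>
      rcases hτ with ⟨σ, hσ, hτ⟩ | rfl
      · have hm := equivariant_mem_suspension hF (Subgroup.mem_map_of_mem (arcConj hk φ) hσ)
        obtain ⟨τ', hτ'⟩ := exists_descent_of_mem hk hF hg hG hFk hm
        rw [hτ.unique hk hF hFf (isExtension_of_isLift hk hF hFf hτ')]
        exact ⟨_, hm, hτ'⟩
      · exact ⟨F, step_mem_suspension hF _, hFf⟩
    | one => exact ⟨1, one_mem _, isLift_one⟩
    | mul a b _ _ ha hb =>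
      obtain ⟨y, hy, hya⟩ := ha
      obtain ⟨z, hz, hzb⟩ := hb
      exact ⟨y * z, mul_mem hy hz, hya.mul hzb⟩
    | inv a _ ha =>
      obtain ⟨y, hy, hya⟩ := ha
      exact ⟨y⁻¹, inv_mem hy, hya.inv⟩
  transl_mem := transl_mem_suspension hk hF hg hFk

end

/-- Conjugacy of groups acting on the circle, in terms of their preimages in the line. -/
lemma map_conj_eq_iff {k l : ℕ} (hk : 1 ≤ k) (hl : 1 ≤ l) {Φ : ℝ ≃o ℝ} {ψ : Circle ≃ₜ Circle}
    (hΦ : IsLift k l Φ ψ) {H H' : Subgroup (Circle ≃ₜ Circle)} {S S' : Subgroup (ℝ ≃o ℝ)}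
    (hH : IsPreimage k H S) (hH' : IsPreimage l H' S') :
    H.map (MulAut.conj ψ).toMonoidHom = H' ↔ Conjugates Φ S S' := by
  have hconj : ∀ {x τ}, IsLift k k x τ → IsLift l l (Φ * x * Φ⁻¹) (ψ * τ * ψ⁻¹) :=
    fun h => (hΦ.mul h).mul hΦ.inv
  have hconj' : ∀ {x τ}, IsLift l l x τ → IsLift k k (Φ⁻¹ * x * Φ) (ψ⁻¹ * τ * ψ) :=
    fun h => (hΦ.inv.mul h).mul hΦ
  constructor
  · rintro rfl x
    constructor
    · intro hx
      obtain ⟨τ, hτ, hxτ⟩ := hH.descend x hx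
      exact (hH'.mem_iff hl (hconj hxτ)).1 ⟨τ, hτ, rfl⟩
    · intro hx
      obtain ⟨τ, ⟨τ', hτ', rfl⟩, hxτ⟩ := hH'.descend _ hx
      have h1 := hconj' hxτ
      refine (hH.mem_iff hk (τ := τ') ?_).1 hτ'
      convert h1 using 1
      · group
      · change τ' = ψ⁻¹ * (ψ * τ' * ψ⁻¹) * ψ
        group
  · intro h
    ext τ
    constructor
    · rintro ⟨τ, hτ, rfl⟩
      obtain ⟨x, hx, hxτ⟩ := hH.lift τ hτ
      exact (hH'.mem_iff hl (hconj hxτ)).2 ((h x).1 hx)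
    · intro hτ
      obtain ⟨x, hx, hxτ⟩ := hH'.lift τ hτ
      have hx' := (h.symm x).1 hx
      rw [inv_inv] at hx'
      refine ⟨ψ⁻¹ * τ * ψ, (hH.mem_iff hk (hconj' hxτ)).2 hx', ?_⟩
      change ψ * (ψ⁻¹ * τ * ψ) * ψ⁻¹ = τ
      group

/-! ### Circle groups, their suspensions and the matrix criterion -/

lemma IsRoot.isPreimage {h : ℝ ≃ₜ Ioo (0 : ℝ) 1} {α : ℝ} {n k : ℕ} (hk : 1 ≤ k) {φ : ArcChart k}
    {g : ℝ ≃o ℝ} {f : Circle ≃ₜ Circle} (hf : IsRoot φ g f) (hg : g ∈ lineGroup h α (n - 2)) :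
    ∃ (F : ℝ ≃o ℝ) (hF : IsStep F), F ^ k = equivariant hF (arcConj hk φ g) * transl k ∧
      IsPreimage k (circleGroup h α n φ f)
        (suspension hF ((lineGroup h α (n - 2)).map (arcConj hk φ))) := by
  obtain ⟨F, hF, hFf, hFk⟩ := hf.exists_lift hk
  exact ⟨F, hF, hFk, isPreimage_closure hk hF hFf hg (lineGroup_comm h α _) hFk⟩

lemma exists_fixedPointFree_arcConj (h : ℝ ≃ₜ Ioo (0 : ℝ) 1) {k : ℕ} (hk : 1 ≤ k)
    (φ : ArcChart k) (α : ℝ) (m : ℕ) :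
    ∃ u ∈ (lineGroup h α m).map (arcConj hk φ), ∀ y, u y ≠ y :=
  exists_fixedPointFree h _ α m

theorem exists_matrix_of_topConjugate {h : ℝ ≃ₜ Ioo (0 : ℝ) 1} {n n' k k' : ℕ} (hn : 2 ≤ n)
    (hn' : 2 ≤ n') (hk : 1 ≤ k) (hk' : 1 ≤ k') {α α' : ℝ} (hα : Irrational α)
    {φ : ArcChart k} {φ' : ArcChart k'} {g g' : ℝ ≃o ℝ}
    (hg : g ∈ lineGroup h α (n - 2)) (hg' : g' ∈ lineGroup h α' (n' - 2))
    {f f' : Circle ≃ₜ Circle} (hf : IsRoot φ g f) (hf' : IsRoot φ' g' f')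
    (H : TopConjugate (circleGroup h α n φ f) (circleGroup h α' n' φ' f')) :
    n = n' ∧ k = k' ∧
        ∃ (A : GL (Fin 2) ℤ) (C : Matrix (Fin 2) (Fin (n - 2)) ℤ)
          (B : Matrix (Fin (n - 2)) (Fin (n - 2)) ℤ) (u v w : Fin 2 ⊕ Fin (n - 2) → ℤ),
          MoebiusRel A α α' ∧ B.BlockTriangular id ∧ (∀ i, B i i = 1) ∧
          g = ofCoords h α (n - 2) v ∧ g' = ofCoords h α' (n - 2) u ∧
          v = (Matrix.fromBlocks A.1 C 0 B).mulVec u + (k : ℤ) • w := by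
  obtain ⟨F, hF, hFk, hP⟩ := hf.isPreimage hk hg
  obtain ⟨F', hF', hFk', hP'⟩ := hf'.isPreimage hk' hg'
  obtain ⟨ψ, hψ, hψH⟩ := H
  obtain ⟨Φ, hΦ⟩ := hψ.exists_isLift hk hk'
  have hconj := ((map_conj_eq_iff hk hk' hΦ hP hP').1 hψH).symm
  have htr := hΦ.inv.conj_transl hk' hk
  set Ψ := Φ⁻¹
  obtain ⟨w, _, ⟨γ, hγ, rfl⟩, hw, hE, hΨF⟩ := hconj.of_suspension hF hF'
    (exists_fixedPointFree_arcConj h hk φ α _)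
    (exists_fixedPointFree_arcConj h hk' φ' α' _)
    (map_comm _ (lineGroup_comm h α _))
  obtain ⟨e, he⟩ := exists_arcConj_eq hk hk' φ φ'
  -- The change of charts `e` is removed from `w`, leaving a conjugacy `θ` between the line groups
  -- themselves.
  obtain ⟨θ, hθ⟩ := intervalConj_surjective (unitChart hk φ).toHomeomorph (w * e⁻¹)
  change arcConj hk φ θ = w * e⁻¹ at hθ
  have hθc : ∀ σ, arcConj hk φ (θ * σ * θ⁻¹) = w * arcConj hk' φ' σ * w⁻¹ := by
    intro σ
    rw [map_mul, map_mul, map_inv, hθ, he]; group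
  have hinj : Function.Injective (arcConj hk φ) := intervalConj_injective _
  have hinj' : Function.Injective (arcConj hk' φ') := intervalConj_injective _
  have hθG : Conjugates θ (lineGroup h α' (n' - 2)) (lineGroup h α (n - 2)) := by
    intro σ
    rw [← Subgroup.mem_map_iff_mem hinj', hw, ← hθc, Subgroup.mem_map_iff_mem hinj]
  have hnn : n = n' := by have := hθG.rank_eq; omega
  subst hnn
  -- Write both deck transformations as powers of the steps and use that `Ψ` carries one to the
  -- other. Floors then give `k = k'`, and cancelling `F ^ k` gives `(θ g' θ⁻¹)⁻¹ γ ^ k = g⁻¹`.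
  have hkey : equivariant hF (arcConj hk φ (θ * g' * θ⁻¹)⁻¹ * arcConj hk φ γ ^ k') * F ^ k' =
      equivariant hF (arcConj hk φ g⁻¹) * F ^ k := by
    have h1 : Ψ * transl k' * Ψ⁻¹ =
        (Ψ * equivariant hF' (arcConj hk' φ' g') * Ψ⁻¹)⁻¹ * (Ψ * F' * Ψ⁻¹) ^ k' := by
      rw [conj_pow, hFk']; group
    rw [htr, hE _ (Subgroup.mem_map_of_mem _ hg'), ← hθc, hΨF,
      (equivariant_commute hF _).mul_pow, ← mul_assoc] at h1
    rw [hFk, map_inv, map_inv, map_mul, map_pow, map_inv, map_inv, inv_mul_cancel_left, h1]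
  have hkk : k = k' := by
    have h1 := floor_suspension hF (arcConj hk φ (θ * g' * θ⁻¹)⁻¹ * arcConj hk φ γ ^ k') k' 0
    have h2 := floor_suspension hF (arcConj hk φ g⁻¹) k 0
    rw [zpow_natCast] at h1 h2
    rw [hkey, h2] at h1
    omega
  subst hkk
  rw [mul_left_inj, (equivariant_injective hF).eq_iff, ← map_pow, ← map_mul, hinj.eq_iff] at hkey
  obtain ⟨A, C, B, hA, hB, hB1, hu⟩ := hθG.exists_matrix hα
  obtain ⟨u, rfl⟩ := exists_ofCoords h α' _ hg'
  obtain ⟨c, rfl⟩ := exists_ofCoords h α _ hγ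
  -- The previous relation reads `g = θ g' θ⁻¹ γ ^ (-k)`, hence the sign of `c`.
  refine ⟨rfl, rfl, A, C, B, u, _, -c, hA, hB, hB1, ?_, rfl, rfl⟩
  rw [hu] at hkey
  rw [ofCoords_add, ofCoords_zsmul, ← neg_one_zsmul c, ofCoords_zsmul, zpow_neg_one,
    lineGroup_comm h α _ _ (ofCoords_mem _ _ _ _) _ (zpow_mem (inv_mem (ofCoords_mem _ _ _ _)) _),
    ← inv_inj, ← hkey, zpow_natCast]
  group

theorem topConjugate_of_matrix {h : ℝ ≃ₜ Ioo (0 : ℝ) 1} {n k : ℕ} (hk : 1 ≤ k) {α α' : ℝ}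
    {φ φ' : ArcChart k} {g g' : ℝ ≃o ℝ}
    (hg : g ∈ lineGroup h α (n - 2)) (hg' : g' ∈ lineGroup h α' (n - 2))
    {f f' : Circle ≃ₜ Circle} (hf : IsRoot φ g f) (hf' : IsRoot φ' g' f')
    {A : GL (Fin 2) ℤ} (hA : MoebiusRel A α α') (C : Matrix (Fin 2) (Fin (n - 2)) ℤ)
    {B : Matrix (Fin (n - 2)) (Fin (n - 2)) ℤ} (hB : B.BlockTriangular id)
    (hB1 : ∀ i, B i i = 1) {u v w : Fin 2 ⊕ Fin (n - 2) → ℤ}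
    (hv : g = ofCoords h α (n - 2) v) (hu : g' = ofCoords h α' (n - 2) u)
    (huv : v = (Matrix.fromBlocks A.1 C 0 B).mulVec u + (k : ℤ) • w) :
    TopConjugate (circleGroup h α n φ f) (circleGroup h α' n φ' f') := by
  obtain ⟨F, hF, hFk, hP⟩ := hf.isPreimage hk hg
  obtain ⟨F', hF', hFk', hP'⟩ := hf'.isPreimage hk hg'
  obtain ⟨θ, hθ⟩ := exists_conj_of_matrix h hA C hB hB1
  have hθG := conjugates_of_matrix A C hB hB1 hθ
  obtain ⟨e, he⟩ := exists_arcConj_eq hk hk φ φ'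
  have hθc : ∀ σ, arcConj hk φ (θ * σ * θ⁻¹) =
      arcConj hk φ θ * e * arcConj hk φ' σ * (arcConj hk φ θ * e)⁻¹ := by
    intro σ
    rw [map_mul, map_mul, map_inv, he σ]; group
  have hinj : Function.Injective (arcConj hk φ) := intervalConj_injective _
  have hw : Conjugates (arcConj hk φ θ * e) ((lineGroup h α' (n - 2)).map (arcConj hk φ'))
      ((lineGroup h α (n - 2)).map (arcConj hk φ)) := by
    intro x
    obtain ⟨σ, rfl⟩ := intervalConj_surjective (unitChart hk φ').toHomeomorph x
    have hinj' : Function.Injective (arcConj hk φ') := intervalConj_injective _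
    change arcConj hk φ' σ ∈ _ ↔ _ * arcConj hk φ' σ * _ ∈ _
    rw [← hθc, Subgroup.mem_map_iff_mem hinj, Subgroup.mem_map_iff_mem hinj', hθG σ]
  -- The step is changed by the element with coordinates `-w`: its `k`-th power cancels the term `k
  -- w` of `v`, so that `Ψ` commutes with the deck transformation and descends.
  obtain ⟨Ψ, -, hE, hΨF⟩ := exists_conj_suspension hF hF'
    (map_comm _ (lineGroup_comm h α _)) hw
    (Subgroup.mem_map_of_mem (arcConj hk φ) (ofCoords_mem h α _ (-w)))
  have hconj := conjugates_suspension hF hF' hw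
    (Subgroup.mem_map_of_mem (arcConj hk φ) (ofCoords_mem h α _ (-w))) hE hΨF
  have htr : Ψ * transl k * Ψ⁻¹ = transl k := by
    have h1 : Ψ * transl k * Ψ⁻¹ =
        (Ψ * equivariant hF' (arcConj hk φ' g') * Ψ⁻¹)⁻¹ * (Ψ * F' * Ψ⁻¹) ^ k := by
      rw [conj_pow, hFk']; group
    rw [h1, hE _ (Subgroup.mem_map_of_mem _ hg'), ← hθc, hΨF, (equivariant_commute hF _).mul_pow,
      hFk, hu, hθ, ← mul_assoc, ← mul_assoc, mul_eq_right, hv, huv]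
    simp only [← map_pow, ← map_inv, ← map_mul]
    rw [ofCoords_add, ofCoords_zsmul, ← neg_one_zsmul w, ofCoords_zsmul, zpow_neg_one,
      lineGroup_comm h α _ _ (ofCoords_mem _ _ _ _) _ (zpow_mem (ofCoords_mem _ _ _ _) _),
      zpow_natCast, ← map_one (equivariant hF), ← map_one (arcConj hk φ)]
    congr 2
    group
  rw [mul_inv_eq_iff_eq_mul] at htr
  obtain ⟨ψ, hψ, hΨψ⟩ := exists_descent (Ψ := Ψ⁻¹) hk hk (by
    rw [inv_inv, mul_assoc, ← htr, inv_mul_cancel_left])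
  exact ⟨ψ, hψ, (map_conj_eq_iff hk hk hΨψ hP hP').2 hconj.symm⟩

/-- The factor `m₂ + n₂ α` is a multiplicative cocycle for the Möbius action. -/
lemma MoebiusRel.mul {F A : GL (Fin 2) ℤ} {α β γ : ℝ} (hF : MoebiusRel F α β)
    (hA : MoebiusRel A β γ) : MoebiusRel (F * A) α γ := by
  obtain ⟨hF0, rfl⟩ := hF
  obtain ⟨hA0, rfl⟩ := hA
  have h00 : ((F * A).1 0 0 : ℝ) + (F * A).1 1 0 * α =
      (F.1 0 0 + F.1 1 0 * α) * (A.1 0 0 + A.1 1 0 *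
        ((F.1 0 1 + F.1 1 1 * α) / (F.1 0 0 + F.1 1 0 * α))) := by
    rw [mul_add, mul_left_comm, mul_div_cancel₀ _ hF0.ne']
    simp [Matrix.mul_apply]; ring
  have h01 : ((F * A).1 0 1 : ℝ) + (F * A).1 1 1 * α =
      (F.1 0 0 + F.1 1 0 * α) * (A.1 0 1 + A.1 1 1 *
        ((F.1 0 1 + F.1 1 1 * α) / (F.1 0 0 + F.1 1 0 * α))) := by
    rw [mul_add, mul_left_comm, mul_div_cancel₀ _ hF0.ne']
    simp [Matrix.mul_apply]; ring
  refine ⟨?_, ?_⟩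
  · rw [h00]; exact mul_pos hF0 hA0
  · rw [h00, h01, mul_div_mul_left _ _ hF0.ne']

lemma moebiusRel_one (α : ℝ) : MoebiusRel 1 α α := by simp [MoebiusRel]

end TightCircle

end

theorem theorem7p1
    (h : ℝ ≃ₜ Set.Ioo (0 : ℝ) 1)
    (n n' k k' : ℕ) (hn : 2 ≤ n) (hn' : 2 ≤ n') (hk : 1 ≤ k) (hk' : 1 ≤ k')
    (α α' : ℝ) (hα : Irrational α) (hα' : Irrational α')
    (hα01 : α ∈ Set.Ioo (0 : ℝ) 1) (hα01' : α' ∈ Set.Ioo (0 : ℝ) 1)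
    (φ : ArcChart k) (φ' : ArcChart k')
    (g g' : ℝ ≃o ℝ)
    (hg : g ∈ lineGroup h α (n - 2)) (hg' : g' ∈ lineGroup h α' (n' - 2))
    (hgs : ∀ s : ℕ, 1 ≤ s → Nat.gcd k s ≠ 1 → ¬ ∃ y ∈ lineGroup h α (n - 2), y ^ s = g)
    (hgs' : ∀ s : ℕ, 1 ≤ s → Nat.gcd k' s ≠ 1 → ¬ ∃ y ∈ lineGroup h α' (n' - 2), y ^ s = g')
    (f f' : Circle ≃ₜ Circle) (hf : IsRoot φ g f) (hf' : IsRoot φ' g' f') :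
    TopConjugate (circleGroup h α n φ f) (circleGroup h α' n' φ' f') ↔
      n = n' ∧ k = k' ∧
        ∃ (A : GL (Fin 2) ℤ) (F : GL (Fin 2) ℤ)
          (C : Matrix (Fin 2) (Fin (n - 2)) ℤ) (B : Matrix (Fin (n - 2)) (Fin (n - 2)) ℤ)
          (u v w : Fin 2 ⊕ Fin (n - 2) → ℤ),
          MoebiusRel A α α' ∧ F ∈ stabMatrices α ∧
          B.BlockTriangular id ∧ (∀ i, B i i = 1) ∧
          g = ofCoords h α (n - 2) v ∧ g' = ofCoords h α' (n - 2) u ∧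
          v = (Matrix.fromBlocks F.1 C 0 B * Matrix.fromBlocks A.1 0 0 1).mulVec u
            + (k : ℤ) • w := by
  constructor
  · intro H
    obtain ⟨hnn, hkk, A, C, B, u, v, w, hA, hB, hB1, hv, hu, huv⟩ :=
      exists_matrix_of_topConjugate hn hn' hk hk' hα hg hg' hf hf' H
    -- The matrix obtained from the conjugacy already has the full form, so the stabilizer factor
    -- can be the identity.
    refine ⟨hnn, hkk, A, 1, C, B, u, v, w, hA, moebiusRel_one α, hB, hB1, hv, hu, ?_⟩
    rw [huv, Matrix.fromBlocks_multiply]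
    simp
  · rintro ⟨rfl, rfl, A, F, C, B, u, v, w, hA, hF, hB, hB1, hv, hu, huv⟩
    refine topConjugate_of_matrix hk hg hg' hf hf' (MoebiusRel.mul hF hA) C hB hB1 hv hu (w := w) ?_
    rw [huv, Matrix.fromBlocks_multiply]
    simp
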